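/- Conventions. Manifolds, maps and forms are smooth. Let $V$ be a closed manifold and $\pi\colon V\to B$ a fibre bundle with closed fibres. A *contact fibre bundle* on $\pi$ is a cooriented hyperplane field $\eta=\ker\alpha$ on $V$ that induces a contact structure on every fibre. Put $\xi_{fib}=\eta\cap\ker d\pi$; the *contact connection* of $\eta$ is the distribution $\mathcal H$, the $d\alpha|_\eta$-orthogonal of $\xi_{fib}$ in $\eta$, so that $\eta=\xi_{fib}\oplus\mathcal H$ and $\mathcal H$ is a complement of $\ker d\pi$. The contact fibre bundle $\eta_0=\xi_{fib}\oplus\mathcal H_0$ is *flat* if $\mathcal H_0$ has zero curvature, i.e. brackets of $\mathcal H_0$-horizontal vector fields are $\mathcal H_0$-horizontal. If $\eta=\xi_{fib}\oplus\mathcal H$ is another contact fibre bundle on $\pi$ with the same $\xi_{fib}$, its *potential* $A$ with respect to $\eta_0$ assigns to a vector field $W$ on $B$ the vertical vector field $A_W=\widehat W-\widehat W^0$, where $\widehat W$ and $\widehat W^0$ are the $\mathcal H$- and $\mathcal H_0$-horizontal lifts of $W$. Given a torsion-free covariant derivative $\nabla^B$ on $B$, a *strong Bourgeois contact structure* on the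 flat contact fibre bundle $(\pi,\eta_0)$ is a contact structure $\eta$ on the total space $V$ which is a contact fibre bundle on $\pi$ with the same $\xi_{fib}$ and whose potential is parallel: $$[\widehat U^0,A_W]-A_{\nabla^B_U W}=0\qquad\text{for all vector fields } U,W \text{ on } B .$$ On $\mathbb T^2$ let $\nabla^{\mathbb T^2}$ be the standard flat covariant derivative, with $\nabla^{\mathbb T^2}\partial_{\theta_1}=\nabla^{\mathbb T^2}\partial_{\theta_2}=0$. Two flat contact fibre bundles over $\mathbb T^2$ are *isomorphic* if there is a diffeomorphism of their total spaces over $\mathbb T^2$ whose differential carries $\xi_{fib}$ to $\xi_{fib}$ and the contact connection to the contact connection. Proposition. For every $n\ge 2$ there is a flat contact fibre bundle $(\pi\colon V^{2n+1}\to\mathbb T^2,\eta_0)$ with closed connected fibre of dimension $2n-1$ that admits a strong Bourgeois contact structure for $\nabla^{\mathbb T^2}$ and is non-trivial: for no closed contact manifold $(M^{2n-1},\xi_M)$ is it isomorphic, as a flat contact fibre bundle, to $(M\times\mathbb T^2\to\mathbb T^2,\ \xi_M\oplus T\mathbb T^2)$. -/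

import Mathlib

open scoped Manifold ContDiff

noncomputable section

section Forms

variable {E : Type*} [NormedAddCommGroup E] [NormedSpace ℝ E]
  {H : Type*} [TopologicalSpace H] (I : ModelWithCorners ℝ E H)
  {V : Type*} [TopologicalSpace V] [ChartedSpace H V]

/-- A field of covectors on `V`; it is a differential `1`-form once it is smooth. -/
abbrev OneForm (I : ModelWithCorners ℝ E H) (V : Type*) [TopologicalSpace V] [ChartedSpace H V] :
    Type _ :=
  ∀ p : V, TangentSpace I p →L[ℝ] ℝ

/-- A `1`-form is smooth when the fibrewise linear function `(p, v) ↦ α p v` that it defines on the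
tangent bundle is smooth. -/
def IsSmoothOneForm [IsManifold I ∞ V] (α : OneForm I V) : Prop :=
  ContMDiff I.tangent 𝓘(ℝ, ℝ) ∞ (fun x : TangentBundle I V => α x.proj x.snd)

/-- The `1`-form `α` written in the preferred chart around `p`. -/
def chartForm (α : OneForm I V) (p : V) (y : E) : E →L[ℝ] ℝ :=
  (α ((extChartAt I p).symm y)).comp (mfderiv 𝓘(ℝ, E) I (extChartAt I p).symm y)

/-- The exterior derivative `dα` at `p`, as a bilinear form on `T_p V`, computed in the preferred
chart around `p` by the formula `da (u, v) = (D_u a) v - (D_v a) u`. -/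
def extDerivForm (α : OneForm I V) (p : V) :
    TangentSpace I p →L[ℝ] TangentSpace I p →L[ℝ] ℝ :=
  let D : E →L[ℝ] E →L[ℝ] ℝ := fderiv ℝ (chartForm I α p) (extChartAt I p p)
  let L : E →L[ℝ] E := mfderiv I 𝓘(ℝ, E) (extChartAt I p) p
  let R : E →L[ℝ] E →L[ℝ] ℝ := (D - D.flip).bilinearComp L L
  R

/-- A bilinear form is nondegenerate on a subspace. -/
def NondegenerateOn {T : Type*} [AddCommGroup T] [Module ℝ T] [TopologicalSpace T]
    (b : T →L[ℝ] T →L[ℝ] ℝ) (S : Submodule ℝ T) : Prop :=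
  ∀ v ∈ S, (∀ w ∈ S, b v w = 0) → v = 0

/-- The hyperplane field `ker α`. -/
def kerField (α : OneForm I V) (p : V) : Submodule ℝ (TangentSpace I p) :=
  LinearMap.ker (α p : TangentSpace I p →ₗ[ℝ] ℝ)

/-- `α` is a contact form, i.e. `ker α` is a (cooriented) contact structure: `α` vanishes nowhere
and `dα` is nondegenerate on `ker α` (equivalently `α ∧ (dα)^k` is a volume form, where
`2 k + 1` is the dimension). -/
structure IsContactForm [IsManifold I ∞ V] (α : OneForm I V) : Prop where
  smooth : IsSmoothOneForm I α
  ne_zero : ∀ p, α p ≠ 0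
  nondegenerate : ∀ p, NondegenerateOn (extDerivForm I α p) (kerField I α p)

/-- A vector field is smooth. -/
def IsSmoothVectorField [IsManifold I ∞ V] (X : ∀ p : V, TangentSpace I p) : Prop :=
  ContMDiff I I.tangent ∞ (fun p => (⟨p, X p⟩ : TangentBundle I V))

end Forms

section Bundles

variable {E : Type*} [NormedAddCommGroup E] [NormedSpace ℝ E]
  {H : Type*} [TopologicalSpace H] (I : ModelWithCorners ℝ E H)
  {V : Type*} [TopologicalSpace V] [ChartedSpace H V]
  {EB : Type*} [NormedAddCommGroup EB] [NormedSpace ℝ EB]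
  {HB : Type*} [TopologicalSpace HB] (J : ModelWithCorners ℝ EB HB)
  {B : Type*} [TopologicalSpace B] [ChartedSpace HB B]
  {EF : Type*} [NormedAddCommGroup EF] [NormedSpace ℝ EF]
  {HF : Type*} [TopologicalSpace HF] (K : ModelWithCorners ℝ EF HF)
  (F : Type*) [TopologicalSpace F] [ChartedSpace HF F]

/-- `π : V → B` is a smooth fibre bundle with fibre `F`: it is smoothly locally trivial. -/
def IsSmoothFibreBundle (π : V → B) : Prop :=
  ∀ b : B, ∃ e : Bundle.Trivialization F π, b ∈ e.baseSet ∧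
    ContMDiffOn I (J.prod K) ∞ e e.source ∧
    ContMDiffOn (J.prod K) I ∞ e.toOpenPartialHomeomorph.symm e.target

/-- The vertical space `ker (dπ)` at `p`, which is the tangent space of the fibre through `p`. -/
def verticalField (π : V → B) (p : V) : Submodule ℝ (TangentSpace I p) :=
  LinearMap.ker (mfderiv I J π p : TangentSpace I p →ₗ[ℝ] TangentSpace J (π p))

/-- The distribution `ξ_fib = ker α ∩ ker (dπ)`. -/
def fibreField (π : V → B) (α : OneForm I V) (p : V) : Submodule ℝ (TangentSpace I p) :=
  kerField I α p ⊓ verticalField I J π p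

/-- `ker α` is a contact fibre bundle on `π`: the restriction of `α` to each fibre of `π` is a
contact form of that fibre. (Exterior differentiation commutes with restriction to the fibres.) -/
structure IsContactFibreBundle [IsManifold I ∞ V] (π : V → B) (α : OneForm I V) : Prop where
  smooth : IsSmoothOneForm I α
  ne_zero : ∀ p, ∃ v ∈ verticalField I J π p, α p v ≠ 0
  nondegenerate : ∀ p, NondegenerateOn (extDerivForm I α p) (fibreField I J π α p)

/-- The contact connection of the contact fibre bundle `ker α`: the `dα`-orthogonal of `ξ_fib`
in `ker α`. It depends only on `ker α`. -/
def contactConnection (π : V → B) (α : OneForm I V) (p : V) :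
    Submodule ℝ (TangentSpace I p) where
  carrier := {v | v ∈ kerField I α p ∧ ∀ w ∈ fibreField I J π α p, extDerivForm I α p v w = 0}
  add_mem' := by
    rintro a b ⟨ha, ha'⟩ ⟨hb, hb'⟩
    refine ⟨add_mem ha hb, fun w hw => ?_⟩
    rw [map_add, add_apply, ha' w hw, hb' w hw, add_zero]
  zero_mem' := ⟨zero_mem _, fun w _ => by rw [map_zero]; rfl⟩
  smul_mem' := by
    rintro c a ⟨ha, ha'⟩
    refine ⟨Submodule.smul_mem _ c ha, fun w hw => ?_⟩
    rw [map_smul, smul_apply, ha' w hw, smul_zero]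

/-- A connection (horizontal distribution) has curvature zero: the bracket of any two horizontal
vector fields is horizontal, i.e. has no vertical component. -/
def IsFlatConnection [IsManifold I ∞ V] (𝓗 : ∀ p : V, Submodule ℝ (TangentSpace I p)) : Prop :=
  ∀ X Z : ∀ p : V, TangentSpace I p, IsSmoothVectorField I X → IsSmoothVectorField I Z →
    (∀ p, X p ∈ 𝓗 p) → (∀ p, Z p ∈ 𝓗 p) → ∀ p, VectorField.mlieBracket I X Z p ∈ 𝓗 p

/-- `η₀ = ker α₀` is a flat contact fibre bundle on `π`. -/
structure IsFlatContactFibreBundle [IsManifold I ∞ V] (π : V → B) (α₀ : OneForm I V) : Prop where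
  contactFibreBundle : IsContactFibreBundle I J π α₀
  flat : IsFlatConnection I (contactConnection I J π α₀)

/-- The horizontal lift, with respect to the horizontal distribution `𝓗`, of a vector field `U` on
the base: at `p` it is the vector `v ∈ 𝓗 p` with `dπ v = U (π p)`. -/
def horizontalLift (π : V → B) (𝓗 : ∀ p : V, Submodule ℝ (TangentSpace I p))
    (U : ∀ b : B, TangentSpace J b) (p : V) : TangentSpace I p :=
  Classical.epsilon fun v : TangentSpace I p => v ∈ 𝓗 p ∧ mfderiv I J π p v = U (π p)

/-- The horizontal lift for the contact connection of a contact fibre bundle is unique. -/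
theorem horizontalLift_eq [IsManifold I ∞ V] {π : V → B} {α : OneForm I V}
    (h : IsContactFibreBundle I J π α) {U : ∀ b : B, TangentSpace J b} {p : V}
    {v : TangentSpace I p} (hv : v ∈ contactConnection I J π α p)
    (hU : mfderiv I J π p v = U (π p)) :
    horizontalLift I J π (contactConnection I J π α) U p = v := by
  have hs := Classical.epsilon_spec (p := fun v : TangentSpace I p =>
    v ∈ contactConnection I J π α p ∧ mfderiv I J π p v = U (π p)) ⟨v, hv, hU⟩
  have h1 : horizontalLift I J π (contactConnection I J π α) U p - v ∈
      contactConnection I J π α p := sub_mem hs.1 hv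
  have h2 : horizontalLift I J π (contactConnection I J π α) U p - v ∈
      verticalField I J π p := by
    change mfderiv I J π p _ = 0
    rw [map_sub, hU]
    exact sub_eq_zero.2 hs.2
  exact sub_eq_zero.1 (h.nondegenerate p _ ⟨h1.1, h2⟩ h1.2)

/-- The potential of the contact connection of `ker α` with respect to that of `ker α₀`, evaluated
on a vector field `W` of the base: the vertical vector field `Ŵ - Ŵ⁰`, the difference of the two
horizontal lifts. It is a section of the bundle of contact vector fields of the fibres. -/
def potential (π : V → B) (α₀ α : OneForm I V) (W : ∀ b : B, TangentSpace J b) (p : V) :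
    TangentSpace I p :=
  horizontalLift I J π (contactConnection I J π α) W p -
    horizontalLift I J π (contactConnection I J π α₀) W p

/-- The extended covariant derivative of the potential,
`(∇̄ A) (W, U) = ∇_U (A_W) - A (∇^B_U W)`, where `∇_U σ = [Û⁰, σ]` is the covariant derivative on
fibrewise contact vector fields that is induced by the connection of `ker α₀`. -/
def covDerivPotential [IsManifold J ∞ B] (cov : CovariantDerivative J EB (TangentSpace J : B → Type _))
    (π : V → B) (α₀ α : OneForm I V) (W U : ∀ b : B, TangentSpace J b) (p : V) :
    TangentSpace I p :=
  VectorField.mlieBracket I (horizontalLift I J π (contactConnection I J π α₀) U)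
      (potential I J π α₀ α W) p -
    potential I J π α₀ α (fun b => cov W b (U b)) p

/-- `ker α` is a strong Bourgeois contact structure on the flat contact fibre bundle `(π, ker α₀)`,
for the (torsion-free) covariant derivative `cov` of the base: `ker α` is a contact structure on the total space
and a contact fibre bundle on `π` that induces the same contact structures on the fibres as
`ker α₀`, and its potential is parallel. -/
structure IsStrongBourgeois [IsManifold I ∞ V] [IsManifold J ∞ B]
    (cov : CovariantDerivative J EB (TangentSpace J : B → Type _))
    (π : V → B) (α₀ α : OneForm I V) : Prop where
  contact : IsContactForm I α
  contactFibreBundle : IsContactFibreBundle I J π α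
  fibreField_eq : ∀ p, fibreField I J π α p = fibreField I J π α₀ p
  parallel : ∀ W U : ∀ b : B, TangentSpace J b,
    IsSmoothVectorField J W → IsSmoothVectorField J U →
      ∀ p, covDerivPotential I J cov π α₀ α W U p = 0

end Bundles

section Torus

/-- The torus `T²`. -/
abbrev Torus : Type := Circle × Circle

/-- The model with corners of the torus. -/
abbrev torusModel : ModelWithCorners ℝ (EuclideanSpace ℝ (Fin 1) × EuclideanSpace ℝ (Fin 1))
    (ModelProd (EuclideanSpace ℝ (Fin 1)) (EuclideanSpace ℝ (Fin 1))) :=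
  (𝓡 1).prod (𝓡 1)

/-- The `1`-form `dθ₁` (for `f = Prod.fst`) or `dθ₂` (for `f = Prod.snd`) of the torus,
where `f = exp (i θ)`; it is `Im (f̄ df)`. -/
def torusForm (f : Torus → Circle) (b : Torus) : TangentSpace torusModel b →L[ℝ] ℝ :=
  (Complex.imCLM.comp (ContinuousLinearMap.mul ℝ ℂ (starRingEnd ℂ (f b : ℂ)))).comp
    (mvfderiv torusModel (fun b : Torus => (f b : ℂ)) b)

/-- The curve `t ↦ (exp (i t u₁) b₁, exp (i t u₂) b₂)` in the torus. -/
def torusCurve (u : ℝ × ℝ) (b : Torus) (t : ℝ) : Torus :=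
  (Circle.exp (t * u.1) * b.1, Circle.exp (t * u.2) * b.2)

/-- The constant coefficient vector field `u₁ ∂_θ₁ + u₂ ∂_θ₂` on the torus. -/
def torusField (u : ℝ × ℝ) (b : Torus) : TangentSpace torusModel b :=
  mfderiv 𝓘(ℝ, ℝ) torusModel (torusCurve u b) 0 (1 : ℝ)

/-- The inclusion of the circle in the complex plane is smooth. -/
theorem contMDiff_circleCoe : ContMDiff (𝓡 1) 𝓘(ℝ, ℂ) ∞ (fun z : Circle => (z : ℂ)) :=
  letI := finrank_real_complex_fact'
  contMDiff_coe_sphere (E := ℂ)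

theorem contMDiff_torusCurve (u : ℝ × ℝ) (b : Torus) :
    ContMDiff 𝓘(ℝ, ℝ) torusModel ∞ (torusCurve u b) := by
  have h : ∀ c : ℝ, ContMDiff 𝓘(ℝ, ℝ) (𝓡 1) ∞ (fun t : ℝ => Circle.exp (t * c)) := fun c =>
    contMDiff_circleExp.comp (contDiff_id.mul contDiff_const).contMDiff
  exact ((h u.1).mul contMDiff_const).prodMk ((h u.2).mul contMDiff_const)

theorem torusForm_torusField_aux {f : Torus → Circle} (hf : ContMDiff torusModel (𝓡 1) ∞ f)
    (u : ℝ × ℝ) (b : Torus) (c : ℝ) (h : ∀ t, f (torusCurve u b t) = Circle.exp (t * c) * f b) :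
    torusForm f b (torusField u b) = c := by
  have h0 : torusCurve u b 0 = b := by simp [torusCurve]
  have h1 : MDifferentiableAt torusModel 𝓘(ℝ, ℂ) (fun b : Torus => (f b : ℂ))
      (torusCurve u b 0) :=
    ((contMDiff_circleCoe.comp hf) _).mdifferentiableAt (by simp)
  have h2 : MDifferentiableAt 𝓘(ℝ, ℝ) torusModel (torusCurve u b) 0 :=
    ((contMDiff_torusCurve u b) _).mdifferentiableAt (by simp)
  have h3 := mfderiv_comp (0 : ℝ) h1 h2
  have h4 : HasDerivAt (fun t : ℝ => (f (torusCurve u b t) : ℂ)) (c * Complex.I * f b) 0 := by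
    have : (fun t : ℝ => (f (torusCurve u b t) : ℂ)) =
        fun t : ℝ => Complex.exp ((t : ℂ) * c * Complex.I) * f b := by
      funext t
      rw [h]
      simp [Circle.coe_exp]
    rw [this]
    have h5 : HasDerivAt (fun t : ℝ => (t : ℂ) * c * Complex.I) (((1 : ℝ) : ℂ) * c * Complex.I) 0 :=
      (((hasDerivAt_id (0 : ℝ)).ofReal_comp).mul_const _).mul_const _
    simpa using (h5.cexp).mul_const (f b : ℂ)
  have h6 : mvfderiv torusModel (fun b : Torus => (f b : ℂ)) b (torusField u b) =
      c * Complex.I * f b := by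
    have h7 := congrArg (fun L => L (1 : ℝ)) h3
    rw [mfderiv_eq_fderiv] at h7
    have h8 : fderiv ℝ ((fun b : Torus => (f b : ℂ)) ∘ torusCurve u b) 0 (1 : ℝ) =
        c * Complex.I * f b := by
      rw [fderiv_eq_smul_deriv, one_smul]
      exact h4.deriv
    refine Eq.trans ?_ h8
    refine Eq.trans ?_ h7.symm
    change _ = mfderiv torusModel 𝓘(ℝ, ℂ) (fun b : Torus => (f b : ℂ)) (torusCurve u b 0)
      (torusField u b)
    rw [h0]
    rfl
  change (starRingEnd ℂ (f b : ℂ) *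
    mvfderiv torusModel (fun b : Torus => (f b : ℂ)) b (torusField u b)).im = c
  rw [h6]
  have h9 : starRingEnd ℂ (f b : ℂ) * (f b : ℂ) = 1 := by
    rw [mul_comm, Complex.mul_conj, Circle.normSq_coe]
    simp
  rw [mul_left_comm, h9]
  simp

theorem torusForm_fst_torusField (u : ℝ × ℝ) (b : Torus) :
    torusForm Prod.fst b (torusField u b) = u.1 :=
  torusForm_torusField_aux contMDiff_fst u b _ fun _ => rfl

theorem torusForm_snd_torusField (u : ℝ × ℝ) (b : Torus) :
    torusForm Prod.snd b (torusField u b) = u.2 :=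
  torusForm_torusField_aux contMDiff_snd u b _ fun _ => rfl

theorem torusField_decomp (b : Torus) (v : TangentSpace torusModel b) :
    torusForm Prod.fst b v • torusField (1, 0) b + torusForm Prod.snd b v • torusField (0, 1) b =
      v := by
  let L : TangentSpace torusModel b →ₗ[ℝ] ℝ × ℝ :=
    LinearMap.prod (torusForm Prod.fst b : TangentSpace torusModel b →ₗ[ℝ] ℝ)
      (torusForm Prod.snd b : TangentSpace torusModel b →ₗ[ℝ] ℝ)
  have hL : ∀ u, L (torusField u b) = u := fun u =>
    Prod.ext (torusForm_fst_torusField u b) (torusForm_snd_torusField u b)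
  have : FiniteDimensional ℝ (TangentSpace torusModel b) :=
    inferInstanceAs (FiniteDimensional ℝ
      (EuclideanSpace ℝ (Fin 1) × EuclideanSpace ℝ (Fin 1)))
  have hd : Module.finrank ℝ (TangentSpace torusModel b) = Module.finrank ℝ (ℝ × ℝ) := by
    change Module.finrank ℝ (EuclideanSpace ℝ (Fin 1) × EuclideanSpace ℝ (Fin 1)) = _
    simp
  have hi : Function.Injective L :=
    (LinearMap.injective_iff_surjective_of_finrank_eq_finrank hd).2 fun u => ⟨_, hL u⟩
  apply hi
  rw [map_add, map_smul, map_smul, hL, hL]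
  have : L v = (torusForm Prod.fst b v, torusForm Prod.snd b v) := rfl
  rw [this]
  simp

theorem mdifferentiableAt_torusForm {f : Torus → Circle} (hf : ContMDiff torusModel (𝓡 1) ∞ f)
    {W : ∀ b : Torus, TangentSpace torusModel b} {b : Torus}
    (hW : MDifferentiableAt torusModel torusModel.tangent
      (fun b => (⟨b, W b⟩ : TangentBundle torusModel Torus)) b) :
    MDifferentiableAt torusModel 𝓘(ℝ, ℝ) (fun b => torusForm f b (W b)) b := by
  have hg : ContMDiff torusModel 𝓘(ℝ, ℂ) ∞ (fun b : Torus => (f b : ℂ)) :=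
    contMDiff_circleCoe.comp hf
  have h1 : ContMDiff torusModel.tangent 𝓘(ℝ, ℂ) ∞ (fun x : TangentBundle torusModel Torus =>
      mvfderiv torusModel (fun b : Torus => (f b : ℂ)) x.proj x.snd) :=
    (contMDiff_snd_tangentBundle_modelSpace ℂ 𝓘(ℝ, ℂ)).comp
      (hg.contMDiff_tangentMap (m := ∞) (by simp))
  have h2 : MDifferentiableAt torusModel 𝓘(ℝ, ℂ)
      (fun b => mvfderiv torusModel (fun b : Torus => (f b : ℂ)) b (W b)) b :=
    MDifferentiableAt.comp b ((h1 _).mdifferentiableAt (by simp)) hW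
  have h3 : MDifferentiableAt torusModel 𝓘(ℝ, ℂ) (fun b : Torus => starRingEnd ℂ (f b : ℂ)) b :=
    MDifferentiableAt.comp b
      (Complex.conjCLE.contDiff.contMDiff (n := ∞) _ |>.mdifferentiableAt (by simp))
      ((hg b).mdifferentiableAt (by simp))
  exact MDifferentiableAt.comp b
    (Complex.imCLM.contDiff.contMDiff (n := ∞) _ |>.mdifferentiableAt (by simp)) (h3.mul h2)

/-- The standard flat covariant derivative of the torus, for which `∂_θ₁` and `∂_θ₂` are parallel:
`∇ (w₁ ∂_θ₁ + w₂ ∂_θ₂) = dw₁ ⊗ ∂_θ₁ + dw₂ ⊗ ∂_θ₂`. -/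
def torusFlat : CovariantDerivative torusModel
    (EuclideanSpace ℝ (Fin 1) × EuclideanSpace ℝ (Fin 1))
    (TangentSpace torusModel : Torus → Type _) where
  toFun W b :=
    (mvfderiv torusModel (fun b => torusForm Prod.fst b (W b)) b).smulRight (torusField (1, 0) b) +
    (mvfderiv torusModel (fun b => torusForm Prod.snd b (W b)) b).smulRight (torusField (0, 1) b)
  isCovariantDerivativeOnUniv := by
    have hm : ∀ {f : Torus → Circle}, ContMDiff torusModel (𝓡 1) ∞ f →
        ∀ {W : ∀ b : Torus, TangentSpace torusModel b} {b : Torus},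
        MDifferentiableAt torusModel torusModel.tangent
          (fun b => (⟨b, W b⟩ : TangentBundle torusModel Torus)) b →
        MDifferentiableAt torusModel 𝓘(ℝ, ℝ) (fun b => torusForm f b (W b)) b :=
      fun hf _ _ hW => mdifferentiableAt_torusForm hf hW
    constructor
    · intro σ σ' b hσ hσ' _
      have h : ∀ {f : Torus → Circle}, ContMDiff torusModel (𝓡 1) ∞ f →
          mvfderiv torusModel (fun b => torusForm f b ((σ + σ') b)) b =
            mvfderiv torusModel (fun b => torusForm f b (σ b)) b +
              mvfderiv torusModel (fun b => torusForm f b (σ' b)) b := by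
        intro f hf
        rw [← mvfderiv_add (hm hf hσ) (hm hf hσ')]
        congr 1
        funext b
        simp
      rw [h contMDiff_fst, h contMDiff_snd]
      ext v : 1
      simp [add_smul]
      abel
    · intro σ g b hσ hg _
      have h : ∀ {f : Torus → Circle}, ContMDiff torusModel (𝓡 1) ∞ f →
          mvfderiv torusModel (fun b => torusForm f b ((g • σ) b)) b =
            g b • mvfderiv torusModel (fun b => torusForm f b (σ b)) b +
              torusForm f b (σ b) • mvfderiv torusModel g b := by
        intro f hf
        rw [← mvfderiv_mul hg (hm hf hσ)]
        congr 1
        funext b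
        simp
      rw [h contMDiff_fst, h contMDiff_snd]
      ext v : 1
      have key : ∀ {T : Type} [AddCommGroup T] [Module ℝ T] (e₁ e₂ s : T)
          (w₁ w₂ c d₁ d₂ k : ℝ), w₁ • e₁ + w₂ • e₂ = s →
          (c * d₁ + w₁ * k) • e₁ + (c * d₂ + w₂ * k) • e₂ =
            c • (d₁ • e₁ + d₂ • e₂) + k • s := by
        intro T _ _ e₁ e₂ s w₁ w₂ c d₁ d₂ k hs
        subst hs
        module
      exact key _ _ _ _ _ _ _ _ _ (torusField_decomp b (σ b))

end Torus

section Trivial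

variable {E : Type*} [NormedAddCommGroup E] [NormedSpace ℝ E]
  {H : Type*} [TopologicalSpace H] (I : ModelWithCorners ℝ E H)
  {V : Type*} [TopologicalSpace V] [ChartedSpace H V]
  {EM : Type*} [NormedAddCommGroup EM] [NormedSpace ℝ EM]
  {HM : Type*} [TopologicalSpace HM] (IM : ModelWithCorners ℝ EM HM)
  {M : Type*} [TopologicalSpace M] [ChartedSpace HM M]

/-- The contact structures `ξ_M ⊕ 0` on the fibres of `M × T² → T²`, where `ξ_M = ker β`. -/
def trivialFibreField (β : OneForm IM M) (q : M × Torus) :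
    Submodule ℝ (TangentSpace (IM.prod torusModel) q) :=
  Submodule.prod (kerField IM β q.1) (⊥ : Submodule ℝ (TangentSpace torusModel q.2))

/-- The connection `0 ⊕ TT²` of `M × T² → T²`. -/
def trivialConnection (q : M × Torus) : Submodule ℝ (TangentSpace (IM.prod torusModel) q) :=
  Submodule.prod (⊥ : Submodule ℝ (TangentSpace IM q.1))
    (⊤ : Submodule ℝ (TangentSpace torusModel q.2))

/-- The flat contact fibre bundle `(π, ker α₀)` over the torus is isomorphic to the trivial one
`(M × T² → T², ξ_M ⊕ TT²)` with `ξ_M = ker β`: there is a diffeomorphism over `T²` whose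
differential carries the contact structures of the fibres to those of the fibres, and the
connection to the connection. -/
def IsIsomorphicToTrivial (π : V → Torus) (α₀ : OneForm I V) (β : OneForm IM M) : Prop :=
  ∃ Ψ : V ≃ₘ^∞⟮I, IM.prod torusModel⟯ (M × Torus),
    (∀ p, (Ψ p).2 = π p) ∧
    (∀ p, (fibreField I torusModel π α₀ p).map (mfderiv I (IM.prod torusModel) Ψ p :
      TangentSpace I p →ₗ[ℝ] TangentSpace (IM.prod torusModel) (Ψ p)) =
        trivialFibreField IM β (Ψ p)) ∧
    ∀ p, (contactConnection I torusModel π α₀ p).map (mfderiv I (IM.prod torusModel) Ψ p :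
      TangentSpace I p →ₗ[ℝ] TangentSpace (IM.prod torusModel) (Ψ p)) =
        trivialConnection IM (Ψ p)

end Trivial

/-- A smooth closed manifold of dimension `d`: a nonempty compact Hausdorff smooth manifold without
boundary, modelled on a `d`-dimensional real vector space. -/
structure ClosedManifold (d : ℕ) where
  carrier : Type
  vec : Type
  space : Type
  [normedAddCommGroup : NormedAddCommGroup vec]
  [normedSpace : NormedSpace ℝ vec]
  [finiteDimensional : FiniteDimensional ℝ vec]
  [topSpace : TopologicalSpace space]
  model : ModelWithCorners ℝ vec space
  [boundaryless : model.Boundaryless]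
  [topCarrier : TopologicalSpace carrier]
  [t2 : T2Space carrier]
  [compact : CompactSpace carrier]
  [nonempty : Nonempty carrier]
  [charted : ChartedSpace space carrier]
  [manifold : IsManifold model ∞ carrier]
  finrank_eq : Module.finrank ℝ vec = d

attribute [instance] ClosedManifold.normedAddCommGroup ClosedManifold.normedSpace
  ClosedManifold.finiteDimensional ClosedManifold.topSpace ClosedManifold.boundaryless
  ClosedManifold.topCarrier ClosedManifold.t2 ClosedManifold.compact ClosedManifold.nonempty
  ClosedManifold.charted ClosedManifold.manifold

/-! The total space is S × T² with S the unit sphere of ℂⁿ and contact form λ = ⟨Jz, dz⟩, where J is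
multiplication by i. Every form used has the shape λ + g₁ dθ₁ + g₂ dθ₂. Its restriction to the
fibres does not see the gᵢ, and its connection lifts ∂_θᵢ to ∂_θᵢ + Yᵢ, where Yᵢ is the contact
vector field on S with Hamiltonian -gᵢ (`mem_contactConnection_iff`).

For the flat structure, Y₁ = R is a skew-Hermitian linear field and Y₂ = 0. All horizontal fields
move the sphere along the single field R, so there is no curvature
(`isFlatContactFibreBundle_sphereTorusForm`). The holonomy around the first circle is exp(2πR). Here
R turns the complex line of a basis vector x with speed 1/2, so that exp(2πR) sends x to -x. In a
trivial bundle a horizontal curve has constant component in M, so a horizontal curve whose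
projection closes up must close up too. This excludes an isomorphism
(`not_isIsomorphicToTrivial_sphereTorusForm`).

The Bourgeois structure adds Re z₁ dθ₁ - Im z₁ dθ₂ to the flat form, z₁ being the coordinate along a
basis vector e orthogonal over ℂ to x. The potential then consists of the contact fields V₁, V₂ with
Hamiltonians -Re z₁ and Im z₁. Since R e = 0, the flow of R preserves λ and z₁, hence commutes with
V₁ and V₂: the potential is parallel (`fderiv_linearContactField_apply`,
`isStrongBourgeois_sphereTorusForm`). Since dα is nondegenerate on ξ_fib, the contact condition
reduces to dα ≠ 0 on the lifts of ∂_θ₁, ∂_θ₂. The contributions of R cancel and leave (1 + |z₁|²)/2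
> 0 (`bourgeois_curvature_ne_zero`). Two orthogonal complex lines are needed, which is where n ≥ 2
enters.

The calculus is carried out in the embedding S × T² ⊂ E × ℂ × ℂ: forms are pulled back from there,
and brackets are tested on vector-valued coordinate functions. -/

/-! ### Exterior derivatives, vector fields and Lie brackets in a chart -/

section ChartCalculus

open Set

variable {E : Type*} [NormedAddCommGroup E] [NormedSpace ℝ E]
  {H : Type*} [TopologicalSpace H] {I : ModelWithCorners ℝ E H} [I.Boundaryless]
  {M : Type*} [TopologicalSpace M] [ChartedSpace H M] [IsManifold I ∞ M]
  {A : Type*} [NormedAddCommGroup A] [NormedSpace ℝ A]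

/-- The differential at `p` of the preferred chart around `p`. -/
def chartMap (I : ModelWithCorners ℝ E H) (p : M) : TangentSpace I p →L[ℝ] E :=
  mfderiv I 𝓘(ℝ, E) (extChartAt I p) p

/-- The differential of the inverse of the preferred chart around `p`. -/
def chartMapSymm (I : ModelWithCorners ℝ E H) (p : M) (y : E) :
    E →L[ℝ] TangentSpace I ((extChartAt I p).symm y) :=
  mfderiv 𝓘(ℝ, E) I (extChartAt I p).symm y

theorem mdifferentiableAt_extChartAt_symm (p : M) {y : E} (hy : y ∈ (extChartAt I p).target) :
    MDifferentiableAt 𝓘(ℝ, E) I (extChartAt I p).symm y :=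
  ((contMDiffOn_extChartAt_symm (n := ∞) p).contMDiffAt
    ((isOpen_extChartAt_target p).mem_nhds hy)).mdifferentiableAt (by simp)

theorem isInvertible_mfderiv_extChartAt_symm (p : M) {y : E} (hy : y ∈ (extChartAt I p).target) :
    (chartMapSymm I p y).IsInvertible := by
  have : IsManifold I 1 M := IsManifold.of_le (n := ∞) (by simp)
  have h := isInvertible_mfderivWithin_extChartAt_symm (I := I) hy
  rwa [I.range_eq_univ, mfderivWithin_univ] at h

/-- A function on a manifold, read in the preferred chart around `p`, is smooth. -/
theorem contDiffAt_comp_extChartAt_symm {G : M → A} (hG : ContMDiff I 𝓘(ℝ, A) ∞ G) (p : M) {y : E}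
    (hy : y ∈ (extChartAt I p).target) :
    ContDiffAt ℝ ∞ (G ∘ (extChartAt I p).symm) y :=
  ((hG _).comp y ((contMDiffOn_extChartAt_symm (n := ∞) p).contMDiffAt
    ((isOpen_extChartAt_target p).mem_nhds hy))).contDiffAt

theorem mvfderiv_mfderiv_extChartAt_symm {G : M → A} {p : M} {y : E}
    (hG : MDifferentiableAt I 𝓘(ℝ, A) G ((extChartAt I p).symm y))
    (hy : y ∈ (extChartAt I p).target) (u : E) :
    mvfderiv I G ((extChartAt I p).symm y) (chartMapSymm I p y u) =
      fderiv ℝ (G ∘ (extChartAt I p).symm) y u := by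
  have h := mfderiv_comp y hG (mdifferentiableAt_extChartAt_symm p hy)
  rw [mfderiv_eq_fderiv] at h
  exact (congrArg (fun L => L u) h).symm

theorem mvfderiv_eq_fderiv_extChartAt {G : M → A} {p : M} (hG : MDifferentiableAt I 𝓘(ℝ, A) G p)
    (v : TangentSpace I p) :
    mvfderiv I G p v = fderiv ℝ (G ∘ (extChartAt I p).symm) (extChartAt I p p)
      (chartMap I p v) := by
  have hd : DifferentiableAt ℝ (G ∘ (extChartAt I p).symm) (extChartAt I p p) := by
    have h1 : MDifferentiableAt I 𝓘(ℝ, A) G ((extChartAt I p).symm (extChartAt I p p)) := by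
      rwa [extChartAt_to_inv]
    exact (h1.comp _ (mdifferentiableAt_extChartAt_symm p (mem_extChartAt_target p))).differentiableAt
  have he : MDifferentiableAt I 𝓘(ℝ, E) (extChartAt I p) p :=
    have : IsManifold I 1 M := IsManifold.of_le (n := ∞) (by simp)
    mdifferentiableAt_extChartAt (mem_chart_source H p)
  have h := mfderiv_comp p hd.mdifferentiableAt he
  rw [mfderiv_eq_fderiv] at h
  have hc : (G ∘ (extChartAt I p).symm) ∘ extChartAt I p =ᶠ[nhds p] G := by
    filter_upwards [extChartAt_source_mem_nhds (I := I) p] with q hq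
    change G ((extChartAt I p).symm (extChartAt I p q)) = G q
    rw [(extChartAt I p).left_inv hq]
  have h2 := hc.mfderiv_eq (I := I) (I' := 𝓘(ℝ, A))
  rw [h] at h2
  exact (congrArg (fun L => L v) h2).symm

/-- The exterior derivative of the pullback of a `1`-form on a vector space. -/
theorem extDerivForm_pullback {ι : M → A} (hι : ContMDiff I 𝓘(ℝ, A) ∞ ι)
    {a : A → A →L[ℝ] ℝ} (ha : ContDiff ℝ ∞ a) {α : OneForm I M}
    (hα : ∀ q v, α q v = a (ι q) (mvfderiv I ι q v)) (p : M) (u v : TangentSpace I p) :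
    extDerivForm I α p u v =
      fderiv ℝ a (ι p) (mvfderiv I ι p u) (mvfderiv I ι p v) -
      fderiv ℝ a (ι p) (mvfderiv I ι p v) (mvfderiv I ι p u) := by
  set φ := extChartAt I p with hφ
  set g := ι ∘ φ.symm with hg
  set y := φ p with hy
  have hyt : y ∈ φ.target := mem_extChartAt_target p
  have hgy : g y = ι p := by simp [hg, hy, hφ]
  have hg2 : ContDiffAt ℝ ∞ g y := contDiffAt_comp_extChartAt_symm hι p hyt
  have hc : chartForm I α p =ᶠ[nhds y] fun y => (a (g y)).comp (fderiv ℝ g y) := by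
    filter_upwards [(isOpen_extChartAt_target (I := I) p).mem_nhds hyt] with z hz
    ext w
    refine (hα _ _).trans ?_
    exact congrArg (a (g z))
      (mvfderiv_mfderiv_extChartAt_symm ((hι _).mdifferentiableAt (by simp)) hz w)
  have hd1 : HasFDerivAt (fun y => a (g y)) ((fderiv ℝ a (ι p)).comp (fderiv ℝ g y)) y := by
    refine HasFDerivAt.comp y ?_ (hg2.differentiableAt (by simp)).hasFDerivAt
    rw [hgy]
    exact (ha.differentiable (by simp) _).hasFDerivAt
  have hd2 : HasFDerivAt (fderiv ℝ g) (fderiv ℝ (fderiv ℝ g) y) y :=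
    ((hg2.fderiv_right (m := 1) (by norm_cast)).differentiableAt (by simp)).hasFDerivAt
  have hd := hd1.clm_comp hd2
  -- The second derivative of the embedding is symmetric, so it drops out on antisymmetrising and
  -- only the derivative of `a` survives.
  have hs : ∀ s t, fderiv ℝ (fderiv ℝ g) y s t = fderiv ℝ (fderiv ℝ g) y t s := fun s t =>
    hg2.isSymmSndFDerivAt (by simp only [minSmoothness_of_isRCLikeNormedField]; norm_cast) s t
  have e : ∀ s t : E, fderiv ℝ (chartForm I α p) y s t =
      a (ι p) (fderiv ℝ (fderiv ℝ g) y s t) + fderiv ℝ a (ι p) (fderiv ℝ g y s) (fderiv ℝ g y t) := by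
    intro s t
    rw [hc.fderiv_eq, hd.fderiv, hgy]
    simp
  have m : ∀ w : TangentSpace I p, mvfderiv I ι p w =
      fderiv ℝ g y (chartMap I p w) := fun w =>
    mvfderiv_eq_fderiv_extChartAt ((hι _).mdifferentiableAt (by simp)) w
  have hL : extDerivForm I α p u v =
      fderiv ℝ (chartForm I α p) y (chartMap I p u) (chartMap I p v) -
      fderiv ℝ (chartForm I α p) y (chartMap I p v) (chartMap I p u) := rfl
  rw [hL, m, m, e, e, hs, add_sub_add_left_eq_sub]

/-- A vector field, read in the preferred chart around `p`. -/
def chartField (X : ∀ q : M, TangentSpace I q) (p : M) (y : E) : E :=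
  (chartMapSymm I p y).inverse (X ((extChartAt I p).symm y))

theorem mfderiv_chartField (X : ∀ q : M, TangentSpace I q) (p : M) {y : E}
    (hy : y ∈ (extChartAt I p).target) :
    chartMapSymm I p y (chartField X p y) = X ((extChartAt I p).symm y) :=
  (isInvertible_mfderiv_extChartAt_symm p hy).self_apply_inverse _

theorem IsSmoothVectorField.differentiableAt_chartField [CompleteSpace E]
    {X : ∀ q : M, TangentSpace I q}
    (hX : IsSmoothVectorField I X) (p : M) :
    DifferentiableAt ℝ (chartField X p) (extChartAt I p p) := by
  have : IsManifold I 2 M := IsManifold.of_le (n := ∞) (by norm_cast)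
  have hX' : ContMDiff I I.tangent ∞ (fun x => (⟨x, X x⟩ : TangentBundle I M)) := hX
  have h : MDifferentiableWithinAt I I.tangent (fun x => (⟨x, X x⟩ : TangentBundle I M)) univ p :=
    ((hX' p).mdifferentiableAt (by simp)).mdifferentiableWithinAt
  have h2 := h.differentiableWithinAt_mpullbackWithin_vectorField
  rw [I.range_eq_univ, preimage_univ, inter_univ] at h2
  have e : chartField X p = (VectorField.mpullbackWithin 𝓘(ℝ, E) I (extChartAt I p).symm X univ :
      E → E) := by
    funext y
    change _ = (mfderivWithin _ _ _ _ _).inverse _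
    rw [mfderivWithin_univ]
    rfl
  rw [e]
  exact differentiableWithinAt_univ.1 h2

/-- The manifold bracket is by definition transported from the chart; without boundary the range of
the model is everything, so the brackets within sets become ordinary ones. -/
theorem mlieBracket_eq_chartField (X Z : ∀ q : M, TangentSpace I q) (p : M) :
    chartMap I p (VectorField.mlieBracket I X Z p) =
      VectorField.lieBracket ℝ (chartField X p) (chartField Z p) (extChartAt I p p) := by
  have : IsManifold I 1 M := IsManifold.of_le (n := ∞) (by simp)
  let T : (∀ q : M, TangentSpace I q) → E → E := fun Y =>
    VectorField.mpullbackWithin 𝓘(ℝ, E) I (extChartAt I p).symm Y (range I)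
  have e : ∀ Y, T Y = chartField Y p := fun Y => by
    funext y
    change (mfderivWithin _ _ _ _ _).inverse _ = _
    rw [I.range_eq_univ, mfderivWithin_univ]
    rfl
  rw [← e, ← e, ← VectorField.lieBracketWithin_univ]
  have hi : (chartMap I p).IsInvertible :=
    isInvertible_mfderiv_extChartAt (I := I) (mem_extChartAt_source p)
  have h := hi.self_apply_inverse
    (VectorField.lieBracketWithin ℝ (T X) (T Z)
      ((extChartAt I p).symm ⁻¹' univ ∩ range I) (extChartAt I p p))
  refine Eq.trans h ?_
  rw [I.range_eq_univ, preimage_univ, inter_univ]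

theorem mvfderiv_comp_chart {G : M → A} (hG : ContMDiff I 𝓘(ℝ, A) ∞ G)
    (X : ∀ q : M, TangentSpace I q) (p : M) {y : E} (hy : y ∈ (extChartAt I p).target) :
    mvfderiv I G ((extChartAt I p).symm y) (X ((extChartAt I p).symm y)) =
      fderiv ℝ (G ∘ (extChartAt I p).symm) y (chartField X p y) := by
  refine Eq.trans ?_ (mvfderiv_mfderiv_extChartAt_symm ((hG _).mdifferentiableAt (by simp)) hy _)
  exact congrArg (mvfderiv I G ((extChartAt I p).symm y)) (mfderiv_chartField X p hy).symm

theorem mfderiv_extChartAt_apply_field (X : ∀ q : M, TangentSpace I q) (p : M) :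
    chartMap I p (X p) = chartField X p (extChartAt I p p) := by
  have : IsManifold I 1 M := IsManifold.of_le (n := ∞) (by simp)
  have hy := mem_extChartAt_target (I := I) p
  have h1 := mfderiv_chartField X p hy
  have hd : MDifferentiableAt I 𝓘(ℝ, E) (extChartAt I p)
      ((extChartAt I p).symm (extChartAt I p p)) := by
    rw [extChartAt_to_inv]
    exact mdifferentiableAt_extChartAt (mem_chart_source H p)
  have h2 := mfderiv_comp (extChartAt I p p) hd (mdifferentiableAt_extChartAt_symm p hy)
  have h3 : (extChartAt I p) ∘ (extChartAt I p).symm =ᶠ[nhds (extChartAt I p p)] id := by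
    filter_upwards [(isOpen_extChartAt_target (I := I) p).mem_nhds hy] with z hz
    exact (extChartAt I p).right_inv hz
  rw [h3.mfderiv_eq, mfderiv_id] at h2
  have h4 := DFunLike.congr_fun h2 (chartField X p (extChartAt I p p) : E)
  refine Eq.trans ?_ h4.symm
  change _ = mfderiv I 𝓘(ℝ, E) (extChartAt I p) ((extChartAt I p).symm (extChartAt I p p))
    (chartMapSymm I p (extChartAt I p p) _)
  rw [h1, extChartAt_to_inv]
  rfl

/-- If `X` is differentiable then so is the derivative of a smooth function along `X`. -/
theorem mdifferentiableAt_mvfderiv_apply {G : M → A} (hG : ContMDiff I 𝓘(ℝ, A) ∞ G)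
    {X : ∀ q : M, TangentSpace I q} {p : M}
    (hX : DifferentiableAt ℝ (chartField X p) (extChartAt I p p)) :
    MDifferentiableAt I 𝓘(ℝ, A) (fun q => mvfderiv I G q (X q)) p := by
  have : IsManifold I 1 M := IsManifold.of_le (n := ∞) (by simp)
  have hy := mem_extChartAt_target (I := I) p
  have hd2 : DifferentiableAt ℝ (fderiv ℝ (G ∘ (extChartAt I p).symm)) (extChartAt I p p) :=
    (((contDiffAt_comp_extChartAt_symm hG p hy).fderiv_right (m := 1)
      (by norm_cast)).differentiableAt (by simp))
  have h := (hd2.clm_apply hX).mdifferentiableAt.comp p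
    (mdifferentiableAt_extChartAt (I := I) (mem_chart_source H p))
  refine h.congr_of_eventuallyEq ?_
  filter_upwards [extChartAt_source_mem_nhds (I := I) p] with q hq
  have := mvfderiv_comp_chart hG X p ((extChartAt I p).map_source hq)
  rw [(extChartAt I p).left_inv hq] at this
  exact this

/-- The action of a Lie bracket on functions. -/
theorem mvfderiv_mlieBracket {G : M → A} (hG : ContMDiff I 𝓘(ℝ, A) ∞ G)
    {X Z : ∀ q : M, TangentSpace I q} {p : M}
    (hX : DifferentiableAt ℝ (chartField X p) (extChartAt I p p))
    (hZ : DifferentiableAt ℝ (chartField Z p) (extChartAt I p p)) :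
    mvfderiv I G p (VectorField.mlieBracket I X Z p) =
      mvfderiv I (fun q => mvfderiv I G q (Z q)) p (X p) -
      mvfderiv I (fun q => mvfderiv I G q (X q)) p (Z p) := by
  set φ := extChartAt I p with hφ
  set g := G ∘ φ.symm with hg
  set y := φ p with hy
  have hyt : y ∈ φ.target := mem_extChartAt_target p
  have hg2 : ContDiffAt ℝ ∞ g y := contDiffAt_comp_extChartAt_symm hG p hyt
  have hd2 : DifferentiableAt ℝ (fderiv ℝ g) y :=
    (hg2.fderiv_right (m := 1) (by norm_cast)).differentiableAt (by simp)
  -- The product rule for Dg(Z) along X. Exchanging X and Z and subtracting removes the symmetric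
  -- second derivative and leaves Dg applied to the bracket.
  have key : ∀ {X Z : ∀ q : M, TangentSpace I q}, DifferentiableAt ℝ (chartField Z p) y →
      mvfderiv I (fun q => mvfderiv I G q (Z q)) p (X p) =
        fderiv ℝ (fderiv ℝ g) y (chartField X p y) (chartField Z p y) +
          fderiv ℝ g y (fderiv ℝ (chartField Z p) y (chartField X p y)) := by
    intro X Z hZ
    rw [mvfderiv_eq_fderiv_extChartAt (mdifferentiableAt_mvfderiv_apply hG hZ),
      mfderiv_extChartAt_apply_field]
    have he : (fun q => mvfderiv I G q (Z q)) ∘ φ.symm =ᶠ[nhds y]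
        fun z => fderiv ℝ g z (chartField Z p z) := by
      filter_upwards [(isOpen_extChartAt_target (I := I) p).mem_nhds hyt] with z hz
      exact mvfderiv_comp_chart hG Z p hz
    rw [he.fderiv_eq, (hd2.hasFDerivAt.clm_apply hZ.hasFDerivAt).fderiv]
    exact add_comm _ _
  rw [key hX, key hZ, mvfderiv_eq_fderiv_extChartAt ((hG _).mdifferentiableAt (by simp)),
    mlieBracket_eq_chartField, VectorField.lieBracket, map_sub,
    hg2.isSymmSndFDerivAt (by simp only [minSmoothness_of_isRCLikeNormedField]; norm_cast) (chartField X p y)]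
  abel

/-- A vector field is differentiable as soon as its image under an immersion into a vector space
is differentiable. -/
theorem differentiableAt_chartField_of_immersion [FiniteDimensional ℝ E] [FiniteDimensional ℝ A]
    {G : M → A} (hG : ContMDiff I 𝓘(ℝ, A) ∞ G) {X : ∀ q : M, TangentSpace I q} {p : M}
    (hi : Function.Injective (mvfderiv I G p))
    (hX : MDifferentiableAt I 𝓘(ℝ, A) (fun q => mvfderiv I G q (X q)) p) :
    DifferentiableAt ℝ (chartField X p) (extChartAt I p p) := by
  set φ := extChartAt I p with hφ
  set g := G ∘ φ.symm with hg
  set y := φ p with hy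
  have : CompleteSpace E := FiniteDimensional.complete ℝ E
  have hyt : y ∈ φ.target := mem_extChartAt_target p
  have hg2 : ContDiffAt ℝ ∞ g y := contDiffAt_comp_extChartAt_symm hG p hyt
  have hd2 : DifferentiableAt ℝ (fderiv ℝ g) y :=
    (hg2.fderiv_right (m := 1) (by norm_cast)).differentiableAt (by simp)
  have hinj : Function.Injective (fderiv ℝ g y) := by
    intro s t hst
    have h1 : ∀ u, fderiv ℝ g y u = mvfderiv I G (φ.symm y)
        (chartMapSymm I p y u) := fun u =>
      (mvfderiv_mfderiv_extChartAt_symm ((hG _).mdifferentiableAt (by simp)) hyt u).symm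
    rw [h1, h1] at hst
    have hi' : Function.Injective (mvfderiv I G (φ.symm y)) := by
      rwa [hy, extChartAt_to_inv]
    exact (isInvertible_mfderiv_extChartAt_symm p hyt).injective (hi' hst)
  -- A left inverse of the differential at the single point y suffices: P ∘ Dg is the identity at y,
  -- hence invertible nearby, and its inverse depends differentiably on the point. This expresses
  -- the field through its differentiable image.
  obtain ⟨P0, hP0⟩ := LinearMap.exists_leftInverse_of_injective (fderiv ℝ g y : E →ₗ[ℝ] A)
    (LinearMap.ker_eq_bot.2 hinj)
  let P : A →L[ℝ] E := LinearMap.toContinuousLinearMap P0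
  have hP : P.comp (fderiv ℝ g y) = ContinuousLinearMap.id ℝ E := by
    ext u
    exact congrArg (fun L => L u) hP0
  let Q : E → E →L[ℝ] E := fun z => P.comp (fderiv ℝ g z)
  have hQ : DifferentiableAt ℝ Q y := (differentiableAt_const P).clm_comp hd2
  have hQy : Q y = 1 := hP
  have hQi : DifferentiableAt ℝ (fun z => Ring.inverse (Q z)) y := by
    have : DifferentiableAt ℝ (Ring.inverse : (E →L[ℝ] E) → _) (Q y) := by
      rw [hQy]
      exact differentiableAt_inverse isUnit_one
    exact this.comp y hQ
  have hs : DifferentiableAt ℝ ((fun q => mvfderiv I G q (X q)) ∘ φ.symm) y := by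
    have h1 : MDifferentiableAt I 𝓘(ℝ, A) (fun q => mvfderiv I G q (X q)) (φ.symm y) := by
      rwa [hy, extChartAt_to_inv]
    exact (h1.comp y (mdifferentiableAt_extChartAt_symm p hyt)).differentiableAt
  have hfin : DifferentiableAt ℝ (fun z => Ring.inverse (Q z)
      (P (((fun q => mvfderiv I G q (X q)) ∘ φ.symm) z))) y :=
    hQi.clm_apply (P.differentiableAt.comp y hs)
  refine hfin.congr_of_eventuallyEq ?_
  have hu : ∀ᶠ z in nhds y, IsUnit (Q z) := by
    have : {T : E →L[ℝ] E | IsUnit T} ∈ nhds (Q y) := by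
      rw [hQy]
      exact Units.isOpen.mem_nhds isUnit_one
    exact hQ.continuousAt this
  filter_upwards [(isOpen_extChartAt_target (I := I) p).mem_nhds hyt, hu] with z hz hzu
  have h1 := mvfderiv_comp_chart hG X p hz
  change _ = Ring.inverse (Q z) (P (mvfderiv I G (φ.symm z) (X (φ.symm z))))
  rw [h1]
  have h2 := Ring.inverse_mul_cancel _ hzu
  exact (congrArg (fun L : E →L[ℝ] E => L (chartField X p z)) h2).symm

end ChartCalculus

/-! ### Pulled-back forms and curves with zero velocity -/

/-- The pullback of a smooth `1`-form on a vector space is smooth. -/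
theorem isSmoothOneForm_pullback {E : Type*} [NormedAddCommGroup E] [NormedSpace ℝ E]
    {H : Type*} [TopologicalSpace H] {I : ModelWithCorners ℝ E H}
    {M : Type*} [TopologicalSpace M] [ChartedSpace H M] [IsManifold I ∞ M]
    {A : Type*} [NormedAddCommGroup A] [NormedSpace ℝ A] {ι : M → A} (hι : ContMDiff I 𝓘(ℝ, A) ∞ ι)
    {a : A → A →L[ℝ] ℝ} (ha : ContDiff ℝ ∞ a) {α : OneForm I M}
    (hα : ∀ q v, α q v = a (ι q) (mvfderiv I ι q v)) : IsSmoothOneForm I α := by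
  have h1 : ContMDiff I.tangent 𝓘(ℝ, A) ∞ (fun x : TangentBundle I M =>
      mvfderiv I ι x.proj x.snd) :=
    (contMDiff_snd_tangentBundle_modelSpace A 𝓘(ℝ, A)).comp
      (hι.contMDiff_tangentMap (m := ∞) (by simp))
  have h2 : ContMDiff I.tangent 𝓘(ℝ, A →L[ℝ] ℝ) ∞ (fun x : TangentBundle I M => a (ι x.proj)) :=
    ha.contMDiff.comp (hι.comp (Bundle.contMDiff_proj (TangentSpace I)))
  have h3 := h2.clm_apply h1
  unfold IsSmoothOneForm
  simp_rw [hα]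
  exact h3

/-- A curve in a manifold with vanishing derivative is constant. -/
theorem eq_of_mfderiv_curve_eq_zero {E : Type*} [NormedAddCommGroup E] [NormedSpace ℝ E]
    {H : Type*} [TopologicalSpace H] {I : ModelWithCorners ℝ E H}
    {M : Type*} [TopologicalSpace M] [ChartedSpace H M] [IsManifold I ∞ M]
    {γ : ℝ → M} (hγ : MDifferentiable 𝓘(ℝ, ℝ) I γ)
    (h0 : ∀ t, mfderiv 𝓘(ℝ, ℝ) I γ t (1 : ℝ) = 0) (s t : ℝ) : γ s = γ t := by
  have : IsManifold I 1 M := IsManifold.of_le (n := ∞) (by simp)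
  refine IsLocallyConstant.apply_eq_of_preconnectedSpace
    ((IsLocallyConstant.iff_eventually_eq _).2 fun t => ?_) s t
  have hs : ∀ᶠ r in nhds t, γ r ∈ (chartAt H (γ t)).source :=
    (hγ t).continuousAt ((chartAt H (γ t)).open_source.mem_nhds (mem_chart_source H (γ t)))
  obtain ⟨ε, hε, hb⟩ := Metric.eventually_nhds_iff_ball.1 hs
  -- On this ball the curve stays in one chart domain; its chart image is constant there, and the
  -- chart is injective.
  have hd : ∀ r ∈ Metric.ball t ε, HasDerivAt (extChartAt I (γ t) ∘ γ) 0 r := by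
    intro r hr
    have he := mdifferentiableAt_extChartAt (I := I) (hb r hr)
    have hdiff : DifferentiableAt ℝ (extChartAt I (γ t) ∘ γ) r :=
      (he.comp r (hγ r)).differentiableAt
    have h := mfderiv_comp r he (hγ r)
    rw [mfderiv_eq_fderiv] at h
    have h2 : fderiv ℝ (extChartAt I (γ t) ∘ γ) r (1 : ℝ) = 0 := by
      refine (congrArg (fun L => L (1 : ℝ)) h).trans ?_
      change mfderiv I 𝓘(ℝ, E) (extChartAt I (γ t)) (γ r) (mfderiv 𝓘(ℝ, ℝ) I γ r (1 : ℝ)) = 0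
      rw [h0]
      exact map_zero _
    have h3 := hdiff.hasDerivAt
    rwa [← fderiv_apply_one_eq_deriv, h2] at h3
  refine Metric.eventually_nhds_iff_ball.2 ⟨ε, hε, fun r hr => ?_⟩
  have hc := (convex_ball t ε).is_const_of_fderivWithin_eq_zero (𝕜 := ℝ)
    (f := extChartAt I (γ t) ∘ γ)
    (fun x hx => (hd x hx).differentiableAt.differentiableWithinAt)
    (fun x hx => by
      rw [((hd x hx).hasFDerivAt.hasFDerivWithinAt).fderivWithin
        (Metric.isOpen_ball.uniqueDiffWithinAt hx)]
      ext; simp) hr (Metric.mem_ball_self hε)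
  refine (extChartAt I (γ t)).injOn ?_ (mem_extChartAt_source (γ t)) hc
  rw [extChartAt_source]
  exact hb r hr

/-! ### Differentials of the circle coordinates of the torus -/

section TorusDerivative

theorem torusField_eq (b : Torus) (s : TangentSpace torusModel b) :
    torusField (torusForm Prod.fst b s, torusForm Prod.snd b s) b = s := by
  rw [← torusField_decomp b (torusField _ b), torusForm_fst_torusField, torusForm_snd_torusField]
  exact torusField_decomp b s

/-- Every tangent vector is the velocity of a one-parameter curve `torusCurve`, along which f is an
explicit exponential. -/
theorem mvfderiv_circle_coe {f : Torus → Circle} (hf : ContMDiff torusModel (𝓡 1) ∞ f)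
    {b : Torus} {c : ℝ} (s : TangentSpace torusModel b)
    (h : ∀ t, f (torusCurve (torusForm Prod.fst b s, torusForm Prod.snd b s) b t) =
      Circle.exp (t * c) * f b) :
    mvfderiv torusModel (fun b : Torus => (f b : ℂ)) b s = c * Complex.I * f b := by
  set u := (torusForm Prod.fst b s, torusForm Prod.snd b s) with hu
  have h0 : torusCurve u b 0 = b := by simp [torusCurve]
  have h1 : MDifferentiableAt torusModel 𝓘(ℝ, ℂ) (fun b : Torus => (f b : ℂ))
      (torusCurve u b 0) :=
    ((contMDiff_circleCoe.comp hf) _).mdifferentiableAt (by simp)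
  have h2 : MDifferentiableAt 𝓘(ℝ, ℝ) torusModel (torusCurve u b) 0 :=
    ((contMDiff_torusCurve u b) _).mdifferentiableAt (by simp)
  have h3 := mfderiv_comp (0 : ℝ) h1 h2
  have h4 : HasDerivAt (fun t : ℝ => (f (torusCurve u b t) : ℂ)) (c * Complex.I * f b) 0 := by
    have : (fun t : ℝ => (f (torusCurve u b t) : ℂ)) =
        fun t : ℝ => Complex.exp ((t : ℂ) * c * Complex.I) * f b := by
      funext t
      rw [h]
      simp [Circle.coe_exp]
    rw [this]
    have h5 : HasDerivAt (fun t : ℝ => (t : ℂ) * c * Complex.I) (((1 : ℝ) : ℂ) * c * Complex.I) 0 :=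
      (((hasDerivAt_id (0 : ℝ)).ofReal_comp).mul_const _).mul_const _
    simpa using (h5.cexp).mul_const (f b : ℂ)
  have h7 := congrArg (fun L => L (1 : ℝ)) h3
  rw [mfderiv_eq_fderiv] at h7
  have h8 : fderiv ℝ ((fun b : Torus => (f b : ℂ)) ∘ torusCurve u b) 0 (1 : ℝ) =
      c * Complex.I * f b := by
    rw [fderiv_eq_smul_deriv, one_smul]
    exact h4.deriv
  refine Eq.trans ?_ h8
  refine Eq.trans ?_ h7.symm
  change _ = mfderiv torusModel 𝓘(ℝ, ℂ) (fun b : Torus => (f b : ℂ)) (torusCurve u b 0)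
    (torusField u b)
  rw [h0, hu, torusField_eq]
  rfl

theorem mvfderiv_torus_fst (b : Torus) (s : TangentSpace torusModel b) :
    mvfderiv torusModel (fun b : Torus => (b.1 : ℂ)) b s =
      torusForm Prod.fst b s * Complex.I * b.1 :=
  mvfderiv_circle_coe contMDiff_fst s fun _ => rfl

theorem mvfderiv_torus_snd (b : Torus) (s : TangentSpace torusModel b) :
    mvfderiv torusModel (fun b : Torus => (b.2 : ℂ)) b s =
      torusForm Prod.snd b s * Complex.I * b.2 :=
  mvfderiv_circle_coe contMDiff_snd s fun _ => rfl

end TorusDerivative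

/-! ### The sphere times the torus, embedded in E × ℂ × ℂ -/

section SphereTorus

open Metric Module
open scoped RealInnerProductSpace

/-- The product of the unit sphere of `E` with the torus. -/
abbrev SphereTorus (E : Type*) [NormedAddCommGroup E] : Type _ := sphere (0 : E) 1 × Torus

/-- The model with corners of the product of a `d`-dimensional sphere with the torus. -/
abbrev sphereTorusModel (d : ℕ) := (𝓡 d).prod torusModel

variable {E : Type*} [NormedAddCommGroup E] [InnerProductSpace ℝ E] {d : ℕ}
  [Fact (finrank ℝ E = d + 1)]

/-- The embedding of the product of the unit sphere with the torus in `E × ℂ × ℂ`. -/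
def ambientMap (p : SphereTorus E) : E × ℂ × ℂ := (p.1, p.2.1, p.2.2)

/-- The differential of the projection to the sphere, with values in `E`. -/
def sphereDeriv (d : ℕ) [Fact (finrank ℝ E = d + 1)] (p : SphereTorus E) :
    TangentSpace (sphereTorusModel d) p →L[ℝ] E :=
  mvfderiv (sphereTorusModel d) (fun p : SphereTorus E => (p.1 : E)) p

/-- The differential of the projection to the torus. -/
def torusDeriv (d : ℕ) [Fact (finrank ℝ E = d + 1)] (p : SphereTorus E) :
    TangentSpace (sphereTorusModel d) p →L[ℝ] TangentSpace torusModel p.2 :=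
  mfderiv (sphereTorusModel d) torusModel Prod.snd p

/-- The `1`-form `dθ₁` or `dθ₂` on the product of the sphere with the torus. -/
def angleForm (d : ℕ) [Fact (finrank ℝ E = d + 1)] (f : Torus → Circle) (p : SphereTorus E) :
    TangentSpace (sphereTorusModel d) p →L[ℝ] ℝ :=
  (torusForm f p.2).comp (torusDeriv d p)

theorem contMDiff_sphereCoord :
    ContMDiff (sphereTorusModel d) 𝓘(ℝ, E) ∞ (fun p : SphereTorus E => (p.1 : E)) :=
  contMDiff_coe_sphere.comp contMDiff_fst

theorem contMDiff_torusCoord :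
    ContMDiff (sphereTorusModel d) torusModel ∞ (fun p : SphereTorus E => p.2) :=
  contMDiff_snd

theorem contMDiff_circleCoord {f : Torus → Circle} (hf : ContMDiff torusModel (𝓡 1) ∞ f) :
    ContMDiff (sphereTorusModel d) 𝓘(ℝ, ℂ) ∞ (fun p : SphereTorus E => (f p.2 : ℂ)) :=
  contMDiff_circleCoe.comp (hf.comp contMDiff_torusCoord)

theorem contMDiff_ambientMap :
    ContMDiff (sphereTorusModel d) 𝓘(ℝ, E × ℂ × ℂ) ∞ (ambientMap (E := E)) :=
  contMDiff_sphereCoord.prodMk_space ((contMDiff_circleCoord contMDiff_fst).prodMk_space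
    (contMDiff_circleCoord contMDiff_snd))

theorem mvfderiv_comp_torusCoord {A : Type*} [NormedAddCommGroup A] [NormedSpace ℝ A]
    {g : Torus → A} {p : SphereTorus E} (hg : MDifferentiableAt torusModel 𝓘(ℝ, A) g p.2)
    (v : TangentSpace (sphereTorusModel d) p) :
    mvfderiv (sphereTorusModel d) (fun p : SphereTorus E => g p.2) p v =
      mvfderiv torusModel g p.2 (torusDeriv d p v) :=
  DFunLike.congr_fun (mfderiv_comp p hg ((contMDiff_torusCoord (d := d) p).mdifferentiableAt
    (by simp))) v

theorem mvfderiv_comp_sphereCoord {A : Type*} [NormedAddCommGroup A] [NormedSpace ℝ A]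
    {g : E → A} {p : SphereTorus E} (hg : DifferentiableAt ℝ g p.1)
    (v : TangentSpace (sphereTorusModel d) p) :
    mvfderiv (sphereTorusModel d) (fun p : SphereTorus E => g p.1) p v =
      fderiv ℝ g p.1 (sphereDeriv d p v) := by
  have h := mfderiv_comp p hg.mdifferentiableAt ((contMDiff_sphereCoord (d := d) p).mdifferentiableAt
    (by simp))
  rw [mfderiv_eq_fderiv] at h
  exact DFunLike.congr_fun h v

theorem mvfderiv_circle_fst (p : SphereTorus E) (v : TangentSpace (sphereTorusModel d) p) :
    mvfderiv (sphereTorusModel d) (fun p : SphereTorus E => (p.2.1 : ℂ)) p v =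
      angleForm d Prod.fst p v * Complex.I * p.2.1 :=
  (mvfderiv_comp_torusCoord (g := fun b : Torus => (b.1 : ℂ)) (((contMDiff_circleCoe.comp
    contMDiff_fst) _).mdifferentiableAt (by simp)) v).trans (mvfderiv_torus_fst _ _)

theorem mvfderiv_circle_snd (p : SphereTorus E) (v : TangentSpace (sphereTorusModel d) p) :
    mvfderiv (sphereTorusModel d) (fun p : SphereTorus E => (p.2.2 : ℂ)) p v =
      angleForm d Prod.snd p v * Complex.I * p.2.2 :=
  (mvfderiv_comp_torusCoord (g := fun b : Torus => (b.2 : ℂ)) (((contMDiff_circleCoe.comp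
    contMDiff_snd) _).mdifferentiableAt (by simp)) v).trans (mvfderiv_torus_snd _ _)

theorem mvfderiv_prodMk_space {E' : Type*} [NormedAddCommGroup E'] [NormedSpace ℝ E']
    {H : Type*} [TopologicalSpace H] {I : ModelWithCorners ℝ E' H}
    {M : Type*} [TopologicalSpace M] [ChartedSpace H M]
    {A B : Type*} [NormedAddCommGroup A] [NormedSpace ℝ A] [NormedAddCommGroup B] [NormedSpace ℝ B]
    {f : M → A} {g : M → B} {p : M} (hf : MDifferentiableAt I 𝓘(ℝ, A) f p)
    (hg : MDifferentiableAt I 𝓘(ℝ, B) g p) (v : TangentSpace I p) :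
    mvfderiv I (fun q => (f q, g q)) p v = (mvfderiv I f p v, mvfderiv I g p v) := by
  have h := hf.prodMk_space hg
  have h1 := mfderiv_comp p (g := (Prod.fst : A × B → A)) differentiableAt_fst.mdifferentiableAt h
  have h2 := mfderiv_comp p (g := (Prod.snd : A × B → B)) differentiableAt_snd.mdifferentiableAt h
  rw [mfderiv_eq_fderiv, fderiv_fst] at h1
  rw [mfderiv_eq_fderiv, fderiv_snd] at h2
  exact Prod.ext (DFunLike.congr_fun h1 v).symm (DFunLike.congr_fun h2 v).symm

theorem mvfderiv_ambientMap (p : SphereTorus E) (v : TangentSpace (sphereTorusModel d) p) :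
    mvfderiv (sphereTorusModel d) ambientMap p v =
      (sphereDeriv d p v, (angleForm d Prod.fst p v * Complex.I * p.2.1 : ℂ),
        (angleForm d Prod.snd p v * Complex.I * p.2.2 : ℂ)) := by
  have h1 := (contMDiff_circleCoord (E := E) (d := d) contMDiff_fst p).mdifferentiableAt (by simp)
  have h2 := (contMDiff_circleCoord (E := E) (d := d) contMDiff_snd p).mdifferentiableAt (by simp)
  have h3 := (contMDiff_sphereCoord (E := E) (d := d) p).mdifferentiableAt (by simp)
  refine (mvfderiv_prodMk_space h3 (h1.prodMk_space h2) v).trans ?_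
  rw [mvfderiv_prodMk_space h1 h2, mvfderiv_circle_fst, mvfderiv_circle_snd]
  rfl

theorem sphereDeriv_eq (p : SphereTorus E) (v : TangentSpace (𝓡 d) p.1 × TangentSpace torusModel p.2) :
    sphereDeriv d p v = mvfderiv (𝓡 d) ((↑) : sphere (0 : E) 1 → E) p.1 v.1 := by
  have h := mfderiv_comp (I := sphereTorusModel d) (I' := 𝓡 d) (I'' := 𝓘(ℝ, E)) p
    ((contMDiff_coe_sphere (n := d) (E := E) (m := ∞) p.1).mdifferentiableAt (by simp))
    ((contMDiff_fst (I := 𝓡 d) (J := torusModel) (n := ∞) p).mdifferentiableAt (by simp))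
  rw [mfderiv_fst] at h
  exact DFunLike.congr_fun h v

theorem torusDeriv_eq (p : SphereTorus E) (v : TangentSpace (𝓡 d) p.1 × TangentSpace torusModel p.2) :
    torusDeriv d p v = v.2 :=
  DFunLike.congr_fun (mfderiv_snd (I := 𝓡 d) (I' := torusModel) (x := p)) v

theorem inner_sphereDeriv (p : SphereTorus E) (v : TangentSpace (sphereTorusModel d) p) :
    ⟪(p.1 : E), sphereDeriv d p v⟫ = 0 := by
  have h := sphereDeriv_eq p v
  have h2 : sphereDeriv d p v ∈ (ℝ ∙ (p.1 : E))ᗮ := by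
    rw [← range_mvfderiv_subtypeVal (n := d) p.1]
    exact ⟨_, h.symm⟩
  exact Submodule.mem_orthogonal_singleton_iff_inner_right.1 h2

theorem exists_sphereDeriv_torusDeriv (p : SphereTorus E) {U : E} (hU : ⟪(p.1 : E), U⟫ = 0)
    (s : TangentSpace torusModel p.2) :
    ∃ v : TangentSpace (sphereTorusModel d) p, sphereDeriv d p v = U ∧ torusDeriv d p v = s := by
  have h2 : U ∈ (mvfderiv (𝓡 d) ((↑) : sphere (0 : E) 1 → E) p.1).range := by
    rw [range_mvfderiv_subtypeVal (n := d) p.1]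
    exact Submodule.mem_orthogonal_singleton_iff_inner_right.2 hU
  obtain ⟨u, hu⟩ := h2
  exact ⟨(u, s), (sphereDeriv_eq p (u, s)).trans hu, torusDeriv_eq p (u, s)⟩

theorem eq_of_sphereDeriv_eq_of_torusDeriv_eq {p : SphereTorus E}
    {v w : TangentSpace (sphereTorusModel d) p} (h1 : sphereDeriv d p v = sphereDeriv d p w)
    (h2 : torusDeriv d p v = torusDeriv d p w) : v = w := by
  have h3 := (sphereDeriv_eq p v).symm.trans (h1.trans (sphereDeriv_eq p w))
  have h4 := (torusDeriv_eq p v).symm.trans (h2.trans (torusDeriv_eq p w))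
  exact Prod.ext (injective_mvfderiv_subtypeVal_sphere p.1 h3) h4

theorem torus_ext {b : Torus} {s t : TangentSpace torusModel b}
    (h1 : torusForm Prod.fst b s = torusForm Prod.fst b t)
    (h2 : torusForm Prod.snd b s = torusForm Prod.snd b t) : s = t := by
  rw [← torusField_decomp b s, ← torusField_decomp b t, h1, h2]

theorem sphereTorus_ext {p : SphereTorus E}
    {v w : TangentSpace (sphereTorusModel d) p} (h : sphereDeriv d p v = sphereDeriv d p w)
    (h1 : angleForm d Prod.fst p v = angleForm d Prod.fst p w)
    (h2 : angleForm d Prod.snd p v = angleForm d Prod.snd p w) : v = w :=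
  eq_of_sphereDeriv_eq_of_torusDeriv_eq h (torus_ext h1 h2)

theorem exists_sphereDeriv_angleForm (p : SphereTorus E) {U : E} (hU : ⟪(p.1 : E), U⟫ = 0)
    (a b : ℝ) : ∃ v : TangentSpace (sphereTorusModel d) p, sphereDeriv d p v = U ∧
      angleForm d Prod.fst p v = a ∧ angleForm d Prod.snd p v = b := by
  obtain ⟨v, h1, h2⟩ := exists_sphereDeriv_torusDeriv (d := d) p hU (torusField (a, b) p.2)
  refine ⟨v, h1, ?_, ?_⟩
  · change torusForm _ _ (torusDeriv d p v) = _
    rw [h2, torusForm_fst_torusField]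
  · change torusForm _ _ (torusDeriv d p v) = _
    rw [h2, torusForm_snd_torusField]

/-- Makes the embedding an immersion, so that regularity of a vector field can be read off its
ambient coordinates. -/
theorem injective_mvfderiv_ambientMap (p : SphereTorus E) :
    Function.Injective (mvfderiv (sphereTorusModel d) ambientMap p) := by
  intro v w h
  rw [mvfderiv_ambientMap, mvfderiv_ambientMap] at h
  simp only [Prod.mk.injEq] at h
  obtain ⟨h1, h2, h3⟩ := h
  refine sphereTorus_ext h1 ?_ ?_
  · simpa using h2
  · simpa using h3

/-- The `1`-form `Im (w̄ dw)` on `ℂ`. -/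
def argForm : ℂ →L[ℝ] ℂ →L[ℝ] ℝ :=
  (ContinuousLinearMap.compL ℝ ℂ ℂ ℝ Complex.imCLM).comp
    ((ContinuousLinearMap.mul ℝ ℂ).comp (Complex.conjCLE : ℂ →L[ℝ] ℂ))

theorem argForm_apply (w s : ℂ) : argForm w s = (starRingEnd ℂ w * s).im := rfl

theorem argForm_circle (w : Circle) (a : ℝ) : argForm w (a * Complex.I * w) = a := by
  have h9 : starRingEnd ℂ (w : ℂ) * (w : ℂ) = 1 := by
    rw [mul_comm, Complex.mul_conj, Circle.normSq_coe]
    simp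
  rw [argForm_apply, mul_left_comm, h9]
  simp

/-- The pairing is the area form of the plane, and both arguments lie on the same real line. This is
the closedness of dθ. -/
theorem argForm_tangent (w : Circle) (a b : ℝ) :
    argForm (a * Complex.I * w) (b * Complex.I * w) = 0 := by
  have h9 : starRingEnd ℂ (w : ℂ) * (w : ℂ) = 1 := by
    rw [mul_comm, Complex.mul_conj, Circle.normSq_coe]
    simp
  rw [argForm_apply]
  have : starRingEnd ℂ (a * Complex.I * w) * (b * Complex.I * w) = ((a * b : ℝ) : ℂ) := by
    simp only [map_mul, Complex.conj_ofReal, Complex.conj_I, Complex.ofReal_mul]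
    calc _ = (a : ℂ) * b * (-(Complex.I * Complex.I)) * (starRingEnd ℂ (w : ℂ) * w) := by ring
      _ = _ := by rw [h9, Complex.I_mul_I]; ring
  rw [this, Complex.ofReal_im]

/-- The `1`-form `⟨J z, dz⟩ + g₁(z) dθ₁ + g₂(z) dθ₂` on `E × ℂ × ℂ`. -/
def ambientForm (J : E →L[ℝ] E) (g₁ g₂ : E → ℝ) (x : E × ℂ × ℂ) : (E × ℂ × ℂ) →L[ℝ] ℝ :=
  (innerSL ℝ (J x.1)).comp (ContinuousLinearMap.fst ℝ E (ℂ × ℂ)) +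
  g₁ x.1 • (argForm x.2.1).comp
    ((ContinuousLinearMap.fst ℝ ℂ ℂ).comp (ContinuousLinearMap.snd ℝ E (ℂ × ℂ))) +
  g₂ x.1 • (argForm x.2.2).comp
    ((ContinuousLinearMap.snd ℝ ℂ ℂ).comp (ContinuousLinearMap.snd ℝ E (ℂ × ℂ)))

theorem ambientForm_apply (J : E →L[ℝ] E) (g₁ g₂ : E → ℝ) (x y : E × ℂ × ℂ) :
    ambientForm J g₁ g₂ x y =
      ⟪J x.1, y.1⟫ + g₁ x.1 * argForm x.2.1 y.2.1 + g₂ x.1 * argForm x.2.2 y.2.2 := rfl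

theorem contDiff_ambientForm (J : E →L[ℝ] E) {g₁ g₂ : E → ℝ} (h₁ : ContDiff ℝ ∞ g₁)
    (h₂ : ContDiff ℝ ∞ g₂) : ContDiff ℝ ∞ (ambientForm J g₁ g₂) := by
  unfold ambientForm
  have h0 : ContDiff ℝ ∞ (fun x : E × ℂ × ℂ => innerSL ℝ (J x.1)) :=
    (innerSL ℝ : E →L[ℝ] E →L[ℝ] ℝ).contDiff.comp (J.contDiff.comp contDiff_fst)
  have h3 : ContDiff ℝ ∞ (fun x : E × ℂ × ℂ => argForm x.2.1) :=
    argForm.contDiff.comp (contDiff_fst.comp contDiff_snd)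
  have h4 : ContDiff ℝ ∞ (fun x : E × ℂ × ℂ => argForm x.2.2) :=
    argForm.contDiff.comp (contDiff_snd.comp contDiff_snd)
  exact ((h0.clm_comp contDiff_const).add ((h₁.comp contDiff_fst).smul
    (h3.clm_comp contDiff_const))).add ((h₂.comp contDiff_fst).smul (h4.clm_comp contDiff_const))

theorem fderiv_ambientForm_apply (J : E →L[ℝ] E) {g₁ g₂ : E → ℝ} (h₁ : ContDiff ℝ ∞ g₁)
    (h₂ : ContDiff ℝ ∞ g₂) (x u v : E × ℂ × ℂ) :
    fderiv ℝ (ambientForm J g₁ g₂) x u v = ⟪J u.1, v.1⟫ +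
      (fderiv ℝ g₁ x.1 u.1 * argForm x.2.1 v.2.1 + g₁ x.1 * argForm u.2.1 v.2.1) +
      (fderiv ℝ g₂ x.1 u.1 * argForm x.2.2 v.2.2 + g₂ x.1 * argForm u.2.2 v.2.2) := by
  have hd : DifferentiableAt ℝ (ambientForm J g₁ g₂) x :=
    (contDiff_ambientForm J h₁ h₂).differentiable (by simp) x
  -- Freezing the argument v reduces the derivative of a covector field to that of a real function.
  have e1 : fderiv ℝ (ambientForm J g₁ g₂) x u v =
      fderiv ℝ (fun y => ambientForm J g₁ g₂ y v) x u := by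
    rw [fderiv_clm_apply hd (differentiableAt_const v)]
    simp
  rw [e1]
  have hx1 : HasFDerivAt (fun y : E × ℂ × ℂ => y.1) (ContinuousLinearMap.fst ℝ E (ℂ × ℂ)) x :=
    hasFDerivAt_fst
  have hx2 : HasFDerivAt (fun y : E × ℂ × ℂ => y.2.1) ((ContinuousLinearMap.fst ℝ ℂ ℂ).comp
      (ContinuousLinearMap.snd ℝ E (ℂ × ℂ))) x := hasFDerivAt_fst.comp x hasFDerivAt_snd
  have hx3 : HasFDerivAt (fun y : E × ℂ × ℂ => y.2.2) ((ContinuousLinearMap.snd ℝ ℂ ℂ).comp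
      (ContinuousLinearMap.snd ℝ E (ℂ × ℂ))) x := hasFDerivAt_snd.comp x hasFDerivAt_snd
  have k0 := (((innerSL ℝ : E →L[ℝ] E →L[ℝ] ℝ).flip v.1).comp J).hasFDerivAt.comp x hx1
  have k1 := ((h₁.differentiable (by simp) x.1).hasFDerivAt.comp x hx1).mul
    ((argForm.flip v.2.1).hasFDerivAt.comp x hx2)
  have k2 := ((h₂.differentiable (by simp) x.1).hasFDerivAt.comp x hx1).mul
    ((argForm.flip v.2.2).hasFDerivAt.comp x hx3)
  have k := ((k0.add k1).add k2).fderiv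
  refine (DFunLike.congr_fun k u).trans ?_
  change ⟪J u.1, v.1⟫ +
    (g₁ x.1 * argForm u.2.1 v.2.1 + argForm x.2.1 v.2.1 * fderiv ℝ g₁ x.1 u.1) +
    (g₂ x.1 * argForm u.2.2 v.2.2 + argForm x.2.2 v.2.2 * fderiv ℝ g₂ x.1 u.1) = _
  ring

/-- The `1`-form `⟨J z, dz⟩ + g₁(z) dθ₁ + g₂(z) dθ₂` on the product of the sphere with the torus. -/
def sphereTorusForm (d : ℕ) [Fact (finrank ℝ E = d + 1)] (J : E →L[ℝ] E) (g₁ g₂ : E → ℝ) :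
    OneForm (sphereTorusModel d) (SphereTorus E) := fun p =>
  (ambientForm J g₁ g₂ (ambientMap p)).comp (mvfderiv (sphereTorusModel d) ambientMap p)

theorem sphereTorusForm_apply (J : E →L[ℝ] E) (g₁ g₂ : E → ℝ) (p : SphereTorus E)
    (v : TangentSpace (sphereTorusModel d) p) :
    sphereTorusForm d J g₁ g₂ p v = ⟪J p.1, sphereDeriv d p v⟫ +
      g₁ p.1 * angleForm d Prod.fst p v + g₂ p.1 * angleForm d Prod.snd p v := by
  have h : sphereTorusForm d J g₁ g₂ p v = ambientForm J g₁ g₂ (ambientMap p)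
    (mvfderiv (sphereTorusModel d) ambientMap p v) := rfl
  rw [h, mvfderiv_ambientMap, ambientForm_apply]
  simp only [ambientMap]
  rw [argForm_circle, argForm_circle]

/-- This is dλ + dg₁ ∧ dθ₁ + dg₂ ∧ dθ₂. The factor 2 comes from skewness of J, and there are no gᵢ
d(dθᵢ) terms by `argForm_tangent`. -/
theorem extDerivForm_sphereTorusForm (J : E →L[ℝ] E) {g₁ g₂ : E → ℝ} (h₁ : ContDiff ℝ ∞ g₁)
    (h₂ : ContDiff ℝ ∞ g₂) (hJ : ∀ x y, ⟪J x, y⟫ = -⟪x, J y⟫) (p : SphereTorus E)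
    (u v : TangentSpace (sphereTorusModel d) p) :
    extDerivForm (sphereTorusModel d) (sphereTorusForm d J g₁ g₂) p u v =
      2 * ⟪J (sphereDeriv d p u), sphereDeriv d p v⟫ +
      (fderiv ℝ g₁ p.1 (sphereDeriv d p u) * angleForm d Prod.fst p v -
        fderiv ℝ g₁ p.1 (sphereDeriv d p v) * angleForm d Prod.fst p u) +
      (fderiv ℝ g₂ p.1 (sphereDeriv d p u) * angleForm d Prod.snd p v -
        fderiv ℝ g₂ p.1 (sphereDeriv d p v) * angleForm d Prod.snd p u) := by
  rw [extDerivForm_pullback contMDiff_ambientMap (contDiff_ambientForm J h₁ h₂) (fun _ _ => rfl),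
    fderiv_ambientForm_apply J h₁ h₂, fderiv_ambientForm_apply J h₁ h₂, mvfderiv_ambientMap,
    mvfderiv_ambientMap]
  simp only [ambientMap]
  rw [argForm_circle, argForm_circle, argForm_circle, argForm_circle, argForm_tangent,
    argForm_tangent, argForm_tangent, argForm_tangent, hJ (sphereDeriv d p v),
    real_inner_comm (sphereDeriv d p v)]
  ring

theorem isSmoothOneForm_sphereTorusForm (J : E →L[ℝ] E) {g₁ g₂ : E → ℝ} (h₁ : ContDiff ℝ ∞ g₁)
    (h₂ : ContDiff ℝ ∞ g₂) :
    IsSmoothOneForm (sphereTorusModel d) (sphereTorusForm d J g₁ g₂) :=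
  isSmoothOneForm_pullback contMDiff_ambientMap (contDiff_ambientForm J h₁ h₂) (fun _ _ => rfl)

end SphereTorus

theorem norm_sphere {E : Type*} [NormedAddCommGroup E] (p : SphereTorus E) : ‖(p.1 : E)‖ = 1 :=
  norm_eq_of_mem_sphere p.1

/-! ### Contact conditions and connections for λ + g₁ dθ₁ + g₂ dθ₂ -/

section ContactBundles

open Metric Module
open scoped RealInnerProductSpace

variable {E : Type*} [NormedAddCommGroup E] [InnerProductSpace ℝ E] {d : ℕ}
  [Fact (finrank ℝ E = d + 1)]

/-- `J` is an orthogonal complex structure. -/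
structure IsHermitianStructure (J : E →L[ℝ] E) : Prop where
  skew : ∀ x y, ⟪J x, y⟫ = -⟪x, J y⟫
  sq : ∀ x, J (J x) = -x

theorem IsHermitianStructure.inner_self {J : E →L[ℝ] E} (hJ : IsHermitianStructure J) (x : E) :
    ⟪J x, x⟫ = 0 := by
  have := hJ.skew x x
  rw [real_inner_comm (J x) x] at this
  linarith

theorem IsHermitianStructure.inner_map {J : E →L[ℝ] E} (hJ : IsHermitianStructure J) (x y : E) :
    ⟪J x, J y⟫ = ⟪x, y⟫ := by
  rw [hJ.skew, hJ.sq, inner_neg_right, neg_neg]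

/-- Along the unit sphere, `Y` is the contact vector field with contact Hamiltonian `-g` for the
contact form `⟨J z, dz⟩`. -/
structure IsHamiltonianLift (J : E →L[ℝ] E) (g : E → ℝ) (Y : E → E) : Prop where
  tangent : ∀ z, ‖z‖ = 1 → ⟪z, Y z⟫ = 0
  hamiltonian : ∀ z, ‖z‖ = 1 → ⟪J z, Y z⟫ = -g z
  deriv : ∀ z U, ‖z‖ = 1 → ⟪z, U⟫ = 0 → ⟪J z, U⟫ = 0 → 2 * ⟪J (Y z), U⟫ = fderiv ℝ g z U

theorem mem_verticalField_iff {p : SphereTorus E} {v : TangentSpace (sphereTorusModel d) p} :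
    v ∈ verticalField (sphereTorusModel d) torusModel (Prod.snd : SphereTorus E → Torus) p ↔
      angleForm d Prod.fst p v = 0 ∧ angleForm d Prod.snd p v = 0 := by
  have h : v ∈ verticalField (sphereTorusModel d) torusModel (Prod.snd : SphereTorus E → Torus) p ↔
    torusDeriv d p v = 0 := Iff.rfl
  rw [h]
  refine ⟨fun h => ?_, fun h => torus_ext (h.1.trans (map_zero _).symm)
    (h.2.trans (map_zero _).symm)⟩
  constructor
  · change torusForm _ _ (torusDeriv d p v) = 0
    rw [h, map_zero]
  · change torusForm _ _ (torusDeriv d p v) = 0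
    rw [h, map_zero]

/-- The right-hand side is free of g₁ and g₂, so all forms of this family induce the same ξ_fib. -/
theorem mem_fibreField_iff {J : E →L[ℝ] E} {g₁ g₂ : E → ℝ} {p : SphereTorus E}
    {v : TangentSpace (sphereTorusModel d) p} :
    v ∈ fibreField (sphereTorusModel d) torusModel Prod.snd (sphereTorusForm d J g₁ g₂) p ↔
      ⟪J p.1, sphereDeriv d p v⟫ = 0 ∧
        angleForm d Prod.fst p v = 0 ∧ angleForm d Prod.snd p v = 0 := by
  unfold fibreField
  rw [Submodule.mem_inf, mem_verticalField_iff]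
  refine and_congr_left fun h => ?_
  change sphereTorusForm d J g₁ g₂ p v = 0 ↔ _
  rw [sphereTorusForm_apply, h.1, h.2, mul_zero, mul_zero, add_zero, add_zero]

variable {J : E →L[ℝ] E} {g₁ g₂ : E → ℝ}

/-- The fibre direction Jz satisfies λ(Jz) = 1. On ξ_fib, a complex subspace, pairing v with Jv
gives dλ(v, Jv) = 2|v|². -/
theorem isContactFibreBundle_sphereTorusForm (hJ : IsHermitianStructure J)
    (h₁ : ContDiff ℝ ∞ g₁) (h₂ : ContDiff ℝ ∞ g₂) :
    IsContactFibreBundle (sphereTorusModel d) torusModel Prod.snd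
      (sphereTorusForm d J g₁ g₂) where
  smooth := isSmoothOneForm_sphereTorusForm J h₁ h₂
  ne_zero p := by
    obtain ⟨v, hv, ha, hb⟩ := exists_sphereDeriv_angleForm (d := d) p (U := J p.1)
      (by rw [real_inner_comm]; exact hJ.inner_self _) 0 0
    refine ⟨v, mem_verticalField_iff.2 ⟨ha, hb⟩, ?_⟩
    rw [sphereTorusForm_apply, ha, hb, hv, hJ.inner_map, real_inner_self_eq_norm_sq, norm_sphere]
    norm_num
  nondegenerate p v hv h := by
    obtain ⟨h0, ha, hb⟩ := mem_fibreField_iff.1 hv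
    obtain ⟨w, hw, hwa, hwb⟩ := exists_sphereDeriv_angleForm (d := d) p (U := J (sphereDeriv d p v))
      (by rw [← neg_eq_zero, ← hJ.skew, h0]) 0 0
    have hwf : w ∈ fibreField (sphereTorusModel d) torusModel Prod.snd
        (sphereTorusForm d J g₁ g₂) p := mem_fibreField_iff.2
      ⟨by rw [hw, hJ.inner_map, inner_sphereDeriv], hwa, hwb⟩
    have h3 := h w hwf
    rw [extDerivForm_sphereTorusForm J h₁ h₂ hJ.skew, ha, hb, hwa, hwb, hw, hJ.inner_map] at h3
    have h4 : sphereDeriv d p v = 0 := by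
      rw [← inner_self_eq_zero (𝕜 := ℝ)]
      linarith
    exact sphereTorus_ext (h4.trans (map_zero _).symm) (ha.trans (map_zero _).symm)
      (hb.trans (map_zero _).symm)

variable {Y₁ Y₂ : E → E}

/-- Explicit form of the connection: it is spanned by ∂_θᵢ + Yᵢ. The field `hamiltonian` places
these vectors in ker α, and `deriv` makes them dα-orthogonal to ξ_fib. -/
theorem mem_contactConnection_iff (hJ : IsHermitianStructure J)
    (h₁ : ContDiff ℝ ∞ g₁) (h₂ : ContDiff ℝ ∞ g₂) (hY₁ : IsHamiltonianLift J g₁ Y₁)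
    (hY₂ : IsHamiltonianLift J g₂ Y₂) {p : SphereTorus E}
    {v : TangentSpace (sphereTorusModel d) p} :
    v ∈ contactConnection (sphereTorusModel d) torusModel Prod.snd (sphereTorusForm d J g₁ g₂) p ↔
      sphereDeriv d p v =
        angleForm d Prod.fst p v • Y₁ p.1 + angleForm d Prod.snd p v • Y₂ p.1 := by
  have hz := norm_sphere p
  have hmem : v ∈ contactConnection (sphereTorusModel d) torusModel Prod.snd
      (sphereTorusForm d J g₁ g₂) p ↔ sphereTorusForm d J g₁ g₂ p v = 0 ∧
      ∀ w ∈ fibreField (sphereTorusModel d) torusModel Prod.snd (sphereTorusForm d J g₁ g₂) p,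
        extDerivForm (sphereTorusModel d) (sphereTorusForm d J g₁ g₂) p v w = 0 := Iff.rfl
  have hd : ∀ w ∈ fibreField (sphereTorusModel d) torusModel Prod.snd
      (sphereTorusForm d J g₁ g₂) p,
        extDerivForm (sphereTorusModel d) (sphereTorusForm d J g₁ g₂) p v w =
        2 * ⟪J (sphereDeriv d p v - (angleForm d Prod.fst p v • Y₁ p.1 +
          angleForm d Prod.snd p v • Y₂ p.1)), sphereDeriv d p w⟫ := by
    intro w hw
    obtain ⟨h0, ha, hb⟩ := mem_fibreField_iff.1 hw
    rw [extDerivForm_sphereTorusForm J h₁ h₂ hJ.skew, ha, hb,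
      ← hY₁.deriv p.1 _ hz (inner_sphereDeriv p w) h0,
      ← hY₂.deriv p.1 _ hz (inner_sphereDeriv p w) h0]
    simp only [map_sub, map_add, map_smul, inner_sub_left, inner_add_left, real_inner_smul_left]
    ring
  rw [hmem, sphereTorusForm_apply]
  constructor
  · rintro ⟨h0, h⟩
    set U := sphereDeriv d p v - (angleForm d Prod.fst p v • Y₁ p.1 +
          angleForm d Prod.snd p v • Y₂ p.1) with hU
    have hU1 : ⟪(p.1 : E), U⟫ = 0 := by
      rw [hU]
      simp only [inner_sub_right, inner_add_right, real_inner_smul_right, inner_sphereDeriv,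
        hY₁.tangent _ hz, hY₂.tangent _ hz]
      ring
    have hU2 : ⟪J p.1, U⟫ = 0 := by
      rw [hU]
      simp only [inner_sub_right, inner_add_right, real_inner_smul_right,
        hY₁.hamiltonian _ hz, hY₂.hamiltonian _ hz]
      linarith
    -- The defect U is itself in ξ_fib, so JU is an admissible test vector, and it gives 2|U|² = 0.
    obtain ⟨w, hw, hwa, hwb⟩ := exists_sphereDeriv_angleForm (d := d) p (U := J U)
      (by rw [← neg_eq_zero, ← hJ.skew, hU2]) 0 0
    have hwf : w ∈ fibreField (sphereTorusModel d) torusModel Prod.snd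
        (sphereTorusForm d J g₁ g₂) p := mem_fibreField_iff.2
      ⟨by rw [hw, hJ.inner_map, hU1], hwa, hwb⟩
    have h3 := h w hwf
    rw [hd w hwf, hw, hJ.inner_map] at h3
    have h4 : U = 0 := by
      rw [← inner_self_eq_zero (𝕜 := ℝ)]
      linarith
    exact sub_eq_zero.1 h4
  · intro h
    constructor
    · rw [h, inner_add_right, real_inner_smul_right, real_inner_smul_right,
        hY₁.hamiltonian _ hz, hY₂.hamiltonian _ hz]
      ring
    · intro w hw
      rw [hd w hw, sub_eq_zero.2 h, map_zero, inner_zero_left, mul_zero]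

/-- A vector in the radical of dα on ker α is in particular orthogonal to ξ_fib, hence horizontal.
The horizontal space has rank 2, so one number decides: the quantity in `hκ` is dα evaluated on the
lifts of ∂_θ₁ and ∂_θ₂. -/
theorem isContactForm_sphereTorusForm (hJ : IsHermitianStructure J)
    (h₁ : ContDiff ℝ ∞ g₁) (h₂ : ContDiff ℝ ∞ g₂) (hY₁ : IsHamiltonianLift J g₁ Y₁)
    (hY₂ : IsHamiltonianLift J g₂ Y₂)
    (hκ : ∀ z, ‖z‖ = 1 → 2 * ⟪J (Y₁ z), Y₂ z⟫ - fderiv ℝ g₁ z (Y₂ z) + fderiv ℝ g₂ z (Y₁ z) ≠ 0) :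
    IsContactForm (sphereTorusModel d) (sphereTorusForm (E := E) d J g₁ g₂) where
  smooth := isSmoothOneForm_sphereTorusForm J h₁ h₂
  ne_zero p := by
    obtain ⟨v, -, hv⟩ := (isContactFibreBundle_sphereTorusForm (d := d) hJ h₁ h₂).ne_zero p
    intro h
    rw [h] at hv
    exact hv rfl
  nondegenerate p v hv h := by
    have hz := norm_sphere p
    have hv1 := (mem_contactConnection_iff hJ h₁ h₂ hY₁ hY₂).1
      (show v ∈ contactConnection (sphereTorusModel d) torusModel Prod.snd
        (sphereTorusForm d J g₁ g₂) p from ⟨hv, fun w hw => h w hw.1⟩)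
    -- Pairing v with the horizontal lift of a ∂_θ₁ + b ∂_θ₂ produces a determinant times the
    -- curvature.
    have key : ∀ a b : ℝ, (angleForm d Prod.fst p v * b - angleForm d Prod.snd p v * a) *
        (2 * ⟪J (Y₁ p.1), Y₂ p.1⟫ - fderiv ℝ g₁ p.1 (Y₂ p.1) + fderiv ℝ g₂ p.1 (Y₁ p.1)) = 0 := by
      intro a b
      obtain ⟨w, hw, hwa, hwb⟩ := exists_sphereDeriv_angleForm (d := d) p
        (U := a • Y₁ p.1 + b • Y₂ p.1)
        (by rw [inner_add_right, real_inner_smul_right, real_inner_smul_right,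
          hY₁.tangent _ hz, hY₂.tangent _ hz]; ring) a b
      have hwm : w ∈ contactConnection (sphereTorusModel d) torusModel Prod.snd
        (sphereTorusForm d J g₁ g₂) p := (mem_contactConnection_iff hJ h₁ h₂ hY₁ hY₂).2
          (by rw [hw, hwa, hwb])
      have h3 := h w hwm.1
      rw [extDerivForm_sphereTorusForm J h₁ h₂ hJ.skew, hv1, hw, hwa, hwb] at h3
      rw [← h3]
      simp only [map_add, map_smul, inner_add_left, inner_add_right, real_inner_smul_left,
        real_inner_smul_right, hJ.inner_self, smul_eq_mul]
      rw [hJ.skew (Y₂ p.1) (Y₁ p.1), real_inner_comm (J (Y₁ p.1)) (Y₂ p.1)]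
      ring
    have ha : angleForm d Prod.fst p v = 0 := by
      simpa using (mul_eq_zero.1 (key 0 1)).resolve_right (hκ _ hz)
    have hb : angleForm d Prod.snd p v = 0 := by
      simpa using (mul_eq_zero.1 (key 1 0)).resolve_right (hκ _ hz)
    rw [ha, hb, zero_smul, zero_smul, add_zero] at hv1
    exact sphereTorus_ext (hv1.trans (map_zero _).symm) (ha.trans (map_zero _).symm)
      (hb.trans (map_zero _).symm)

/-- Since `horizontalLift` is a choice, it is identified by exhibiting a horizontal vector over W
and invoking uniqueness. -/
theorem horizontalLift_spec (hJ : IsHermitianStructure J)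
    (h₁ : ContDiff ℝ ∞ g₁) (h₂ : ContDiff ℝ ∞ g₂) (hY₁ : IsHamiltonianLift J g₁ Y₁)
    (hY₂ : IsHamiltonianLift J g₂ Y₂) (W : ∀ b : Torus, TangentSpace torusModel b)
    (p : SphereTorus E) :
    sphereDeriv d p (horizontalLift (sphereTorusModel d) torusModel Prod.snd
      (contactConnection (sphereTorusModel d) torusModel Prod.snd (sphereTorusForm d J g₁ g₂)) W p) =
        torusForm Prod.fst p.2 (W p.2) • Y₁ p.1 + torusForm Prod.snd p.2 (W p.2) • Y₂ p.1 ∧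
    torusDeriv d p (horizontalLift (sphereTorusModel d) torusModel Prod.snd
      (contactConnection (sphereTorusModel d) torusModel Prod.snd (sphereTorusForm d J g₁ g₂)) W p) =
        W p.2 := by
  have hz := norm_sphere p
  obtain ⟨v, hv, hv2⟩ := exists_sphereDeriv_torusDeriv (d := d) p
    (U := torusForm Prod.fst p.2 (W p.2) • Y₁ p.1 + torusForm Prod.snd p.2 (W p.2) • Y₂ p.1)
    (by rw [inner_add_right, real_inner_smul_right, real_inner_smul_right,
          hY₁.tangent _ hz, hY₂.tangent _ hz]; ring) (W p.2)
  have hvm : v ∈ contactConnection (sphereTorusModel d) torusModel Prod.snd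
        (sphereTorusForm d J g₁ g₂) p := (mem_contactConnection_iff hJ h₁ h₂ hY₁ hY₂).2 (by
      change _ = torusForm _ _ (torusDeriv d p v) • _ + torusForm _ _ (torusDeriv d p v) • _
      rw [hv, hv2])
  rw [horizontalLift_eq (sphereTorusModel d) torusModel
    (isContactFibreBundle_sphereTorusForm (d := d) hJ h₁ h₂) hvm hv2]
  exact ⟨hv, hv2⟩

end ContactBundles

/-! ### Lie brackets on the sphere times the torus, and flatness -/

section Brackets

open Metric Module
open scoped RealInnerProductSpace

variable {E : Type*} [NormedAddCommGroup E] [InnerProductSpace ℝ E] {d : ℕ}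
  [Fact (finrank ℝ E = d + 1)]

theorem mdifferentiableAt_angleForm_apply {f : Torus → Circle}
    (hf : ContMDiff torusModel (𝓡 1) ∞ f)
    (hfd : ∀ (p : SphereTorus E) (v : TangentSpace (sphereTorusModel d) p),
      mvfderiv (sphereTorusModel d) (fun p : SphereTorus E => (f p.2 : ℂ)) p v =
        angleForm d f p v * Complex.I * f p.2)
    {X : ∀ p : SphereTorus E, TangentSpace (sphereTorusModel d) p} {p : SphereTorus E}
    (hX : DifferentiableAt ℝ (chartField X p) (extChartAt (sphereTorusModel d) p p)) :
    MDifferentiableAt (sphereTorusModel d) 𝓘(ℝ, ℝ) (fun q => angleForm d f q (X q)) p := by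
  have h1 := mdifferentiableAt_mvfderiv_apply (contMDiff_circleCoord (E := E) (d := d) hf) hX
  have h2 := (contMDiff_circleCoord (E := E) (d := d) hf p).mdifferentiableAt (by simp)
  have h3 : MDifferentiableAt (sphereTorusModel d) 𝓘(ℝ, ℝ) (fun q : SphereTorus E =>
      argForm (f q.2) (mvfderiv (sphereTorusModel d) (fun p : SphereTorus E => (f p.2 : ℂ)) q
        (X q))) p := by
    have h4 : DifferentiableAt ℝ (fun x : ℂ × ℂ => argForm x.1 x.2)
        ((f p.2 : ℂ), mvfderiv (sphereTorusModel d) (fun p : SphereTorus E => (f p.2 : ℂ)) p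
        (X p)) :=
      (argForm.differentiableAt.comp _ differentiableAt_fst).clm_apply differentiableAt_snd
    exact h4.mdifferentiableAt.comp p (h2.prodMk_space h1)
  refine h3.congr_of_eventuallyEq (Filter.Eventually.of_forall fun q => ?_)
  change _ = argForm (f q.2) _
  rw [hfd, argForm_circle]

/-- Cartan's formula for the closed form dθ. As θ is not a global function, the bracket is applied
to exp(iθ) and the common factor i exp(iθ) is cancelled. -/
theorem angleForm_mlieBracket {f : Torus → Circle} (hf : ContMDiff torusModel (𝓡 1) ∞ f)
    (hfd : ∀ (p : SphereTorus E) (v : TangentSpace (sphereTorusModel d) p),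
      mvfderiv (sphereTorusModel d) (fun p : SphereTorus E => (f p.2 : ℂ)) p v =
        angleForm d f p v * Complex.I * f p.2)
    {X Z : ∀ p : SphereTorus E, TangentSpace (sphereTorusModel d) p} {p : SphereTorus E}
    (hX : DifferentiableAt ℝ (chartField X p) (extChartAt (sphereTorusModel d) p p))
    (hZ : DifferentiableAt ℝ (chartField Z p) (extChartAt (sphereTorusModel d) p p)) :
    angleForm d f p (VectorField.mlieBracket (sphereTorusModel d) X Z p) =
      mvfderiv (sphereTorusModel d) (fun q => angleForm d f q (Z q)) p (X p) -
      mvfderiv (sphereTorusModel d) (fun q => angleForm d f q (X q)) p (Z p) := by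
  -- The product rule for i dθ(Z) exp(iθ). The last term is symmetric in Z(p) and v, so it
  -- disappears from the commutator.
  have key : ∀ {Z : ∀ p : SphereTorus E, TangentSpace (sphereTorusModel d) p},
      DifferentiableAt ℝ (chartField Z p) (extChartAt (sphereTorusModel d) p p) →
      ∀ v : TangentSpace (sphereTorusModel d) p,
      mvfderiv (sphereTorusModel d) (fun q => mvfderiv (sphereTorusModel d)
        (fun p : SphereTorus E => (f p.2 : ℂ)) q (Z q)) p v =
      (mvfderiv (sphereTorusModel d) (fun q => angleForm d f q (Z q)) p v : ℂ) *
        (Complex.I * f p.2) -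
        angleForm d f p (Z p) * angleForm d f p v * f p.2 := by
    intro Z hZ v
    have e : (fun q => mvfderiv (sphereTorusModel d)
        (fun p : SphereTorus E => (f p.2 : ℂ)) q (Z q)) =
        fun q => angleForm d f q (Z q) •
          ((ContinuousLinearMap.mul ℝ ℂ Complex.I) ∘ fun p : SphereTorus E => (f p.2 : ℂ)) q := by
      funext q
      rw [hfd, mul_assoc]
      exact (Complex.real_smul).symm
    have hw := (contMDiff_circleCoord (E := E) (d := d) hf p).mdifferentiableAt (by simp)
    have hI : MDifferentiableAt 𝓘(ℝ, ℂ) 𝓘(ℝ, ℂ) (ContinuousLinearMap.mul ℝ ℂ Complex.I)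
        (f p.2 : ℂ) := (ContinuousLinearMap.mul ℝ ℂ Complex.I).differentiableAt.mdifferentiableAt
    have h4 := DFunLike.congr_fun (mfderiv_comp p hI hw) v
    rw [mfderiv_eq_fderiv, ContinuousLinearMap.fderiv] at h4
    have h5 : mvfderiv (sphereTorusModel d) ((ContinuousLinearMap.mul ℝ ℂ Complex.I) ∘
        fun p : SphereTorus E => (f p.2 : ℂ)) p v =
        Complex.I * mvfderiv (sphereTorusModel d) (fun p : SphereTorus E => (f p.2 : ℂ)) p v := h4
    rw [e, mvfderiv_fun_smul (mdifferentiableAt_angleForm_apply hf hfd hZ) (hI.comp p hw),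
      add_apply, smul_apply, h5, hfd]
    change angleForm d f p (Z p) • (Complex.I * (angleForm d f p v * Complex.I * f p.2)) +
      mvfderiv (sphereTorusModel d) (fun q => angleForm d f q (Z q)) p v •
      (Complex.I * (f p.2 : ℂ)) = _
    rw [Complex.real_smul, Complex.real_smul]
    linear_combination (angleForm d f p (Z p) * angleForm d f p v * f p.2 : ℂ) * Complex.I_sq
  have h := mvfderiv_mlieBracket (contMDiff_circleCoord (E := E) (d := d) hf) hX hZ
  rw [key hX, key hZ, hfd] at h
  have h2 : (angleForm d f p (VectorField.mlieBracket (sphereTorusModel d) X Z p) : ℂ) *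
      (Complex.I * f p.2) = ((mvfderiv (sphereTorusModel d) (fun q => angleForm d f q (Z q)) p (X p) -
      mvfderiv (sphereTorusModel d) (fun q => angleForm d f q (X q)) p (Z p) : ℝ) : ℂ) *
      (Complex.I * f p.2) := by
    push_cast
    linear_combination h
  exact_mod_cast mul_right_cancel₀ (mul_ne_zero Complex.I_ne_zero (Circle.coe_ne_zero _)) h2

theorem mvfderiv_smul_comp_sphereCoord {τ : SphereTorus E → ℝ} {Y : E → E} {p : SphereTorus E}
    (hτ : MDifferentiableAt (sphereTorusModel d) 𝓘(ℝ, ℝ) τ p) (hY : DifferentiableAt ℝ Y p.1)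
    (v : TangentSpace (sphereTorusModel d) p) :
    mvfderiv (sphereTorusModel d) (fun q : SphereTorus E => τ q • Y q.1) p v =
      τ p • fderiv ℝ Y p.1 (sphereDeriv d p v) + mvfderiv (sphereTorusModel d) τ p v • Y p.1 := by
  have h1 : MDifferentiableAt (sphereTorusModel d) 𝓘(ℝ, E) (fun q : SphereTorus E => Y q.1) p :=
    hY.mdifferentiableAt.comp p ((contMDiff_sphereCoord (d := d) p).mdifferentiableAt (by simp))
  rw [mvfderiv_fun_smul hτ h1, add_apply, smul_apply, mvfderiv_comp_sphereCoord hY]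
  rfl

variable {J : E →L[ℝ] E} {g : E → ℝ} {R : E →L[ℝ] E}

theorem isHamiltonianLift_zero (J : E →L[ℝ] E) : IsHamiltonianLift J 0 0 where
  tangent := by simp
  hamiltonian := by simp
  deriv := by simp

/-- Horizontal fields have sphere component τRz with τ = dθ₁ of the field. In the bracket of two of
them the terms with R² cancel, and the rest is Rz times dθ₁ of the bracket. -/
theorem isFlatContactFibreBundle_sphereTorusForm (hJ : IsHermitianStructure J)
    (hg : ContDiff ℝ ∞ g) (hR : IsHamiltonianLift J g R) :
    IsFlatContactFibreBundle (sphereTorusModel d) torusModel Prod.snd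
      (sphereTorusForm (E := E) d J g 0) where
  contactFibreBundle := isContactFibreBundle_sphereTorusForm hJ hg contDiff_const
  flat X Z hX hZ hXm hZm p := by
    have hm : ∀ {q : SphereTorus E} {v : TangentSpace (sphereTorusModel d) q},
        v ∈ contactConnection (sphereTorusModel d) torusModel Prod.snd
          (sphereTorusForm d J g 0) q ↔ sphereDeriv d q v = angleForm d Prod.fst q v • R q.1 := by
      intro q v
      rw [mem_contactConnection_iff hJ hg (g₂ := 0) contDiff_const hR (isHamiltonianLift_zero J)]
      simp
    have hXd := hX.differentiableAt_chartField p
    have hZd := hZ.differentiableAt_chartField p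
    rw [hm, angleForm_mlieBracket contMDiff_fst mvfderiv_circle_fst hXd hZd]
    have h := mvfderiv_mlieBracket contMDiff_sphereCoord hXd hZd
    have key : ∀ {Z : ∀ p : SphereTorus E, TangentSpace (sphereTorusModel d) p},
        DifferentiableAt ℝ (chartField Z p) (extChartAt (sphereTorusModel d) p p) →
        (∀ q, Z q ∈ contactConnection (sphereTorusModel d) torusModel Prod.snd
          (sphereTorusForm d J g 0) q) → ∀ v : TangentSpace (sphereTorusModel d) p,
        mvfderiv (sphereTorusModel d) (fun q => mvfderiv (sphereTorusModel d)
          (fun p : SphereTorus E => (p.1 : E)) q (Z q)) p v =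
        angleForm d Prod.fst p (Z p) • R (sphereDeriv d p v) +
        mvfderiv (sphereTorusModel d) (fun q => angleForm d Prod.fst q (Z q)) p v • R p.1 := by
      intro Z hZ hZm v
      have e : (fun q => mvfderiv (sphereTorusModel d)
          (fun p : SphereTorus E => (p.1 : E)) q (Z q)) =
          fun q => angleForm d Prod.fst q (Z q) • R q.1 := funext fun q => hm.1 (hZm q)
      rw [e, mvfderiv_smul_comp_sphereCoord (mdifferentiableAt_angleForm_apply contMDiff_fst
        mvfderiv_circle_fst hZ) R.differentiableAt, R.fderiv]
    rw [key hXd hXm, key hZd hZm, hm.1 (hXm p), hm.1 (hZm p), map_smul, map_smul] at h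
    refine Eq.trans h ?_
    module

end Brackets

/-! ### The potential and its covariant derivative -/

section Parallel

open Metric Module
open scoped RealInnerProductSpace

variable {E : Type*} [NormedAddCommGroup E] [InnerProductSpace ℝ E] {d : ℕ}
  [Fact (finrank ℝ E = d + 1)]

theorem mdifferentiableAt_ofReal_mul_I_mul {τ : SphereTorus E → ℝ} {w : SphereTorus E → ℂ}
    {p : SphereTorus E} (hτ : MDifferentiableAt (sphereTorusModel d) 𝓘(ℝ, ℝ) τ p)
    (hw : MDifferentiableAt (sphereTorusModel d) 𝓘(ℝ, ℂ) w p) :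
    MDifferentiableAt (sphereTorusModel d) 𝓘(ℝ, ℂ) (fun q => (τ q * Complex.I * w q : ℂ)) p := by
  have h : DifferentiableAt ℝ (fun x : ℝ × ℂ => x.1 • (Complex.I * x.2)) (τ p, w p) := by
    fun_prop
  refine (h.mdifferentiableAt.comp p (hτ.prodMk_space hw)).congr_of_eventuallyEq
    (Filter.Eventually.of_forall fun q => ?_)
  change _ = τ q • (Complex.I * w q)
  rw [Complex.real_smul]
  exact mul_assoc _ _ _

theorem differentiableAt_chartField_of_coords
    {X : ∀ p : SphereTorus E, TangentSpace (sphereTorusModel d) p} {p : SphereTorus E}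
    (h : MDifferentiableAt (sphereTorusModel d) 𝓘(ℝ, E) (fun q => sphereDeriv d q (X q)) p)
    (h₁ : MDifferentiableAt (sphereTorusModel d) 𝓘(ℝ, ℝ)
      (fun q => angleForm d Prod.fst q (X q)) p)
    (h₂ : MDifferentiableAt (sphereTorusModel d) 𝓘(ℝ, ℝ)
      (fun q => angleForm d Prod.snd q (X q)) p) :
    DifferentiableAt ℝ (chartField X p) (extChartAt (sphereTorusModel d) p p) := by
  have : FiniteDimensional ℝ E := FiniteDimensional.of_fact_finrank_eq_succ d
  refine differentiableAt_chartField_of_immersion contMDiff_ambientMap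
    (injective_mvfderiv_ambientMap p) ?_
  simp_rw [mvfderiv_ambientMap]
  have hw₁ := (contMDiff_circleCoord (E := E) (d := d) contMDiff_fst p).mdifferentiableAt (by simp)
  have hw₂ := (contMDiff_circleCoord (E := E) (d := d) contMDiff_snd p).mdifferentiableAt (by simp)
  exact h.prodMk_space ((mdifferentiableAt_ofReal_mul_I_mul h₁ hw₁).prodMk_space
    (mdifferentiableAt_ofReal_mul_I_mul h₂ hw₂))

theorem torusForm_fst_torusFlat (W : ∀ b : Torus, TangentSpace torusModel b) (b : Torus)
    (s : TangentSpace torusModel b) : torusForm Prod.fst b (torusFlat W b s) =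
      mvfderiv torusModel (fun b => torusForm Prod.fst b (W b)) b s := by
  change torusForm Prod.fst b
    (mvfderiv torusModel (fun b => torusForm Prod.fst b (W b)) b s • torusField (1, 0) b +
    mvfderiv torusModel (fun b => torusForm Prod.snd b (W b)) b s • torusField (0, 1) b) = _
  rw [map_add, map_smul, map_smul, torusForm_fst_torusField, torusForm_fst_torusField]
  simp

theorem torusForm_snd_torusFlat (W : ∀ b : Torus, TangentSpace torusModel b) (b : Torus)
    (s : TangentSpace torusModel b) : torusForm Prod.snd b (torusFlat W b s) =
      mvfderiv torusModel (fun b => torusForm Prod.snd b (W b)) b s := by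
  change torusForm Prod.snd b
    (mvfderiv torusModel (fun b => torusForm Prod.fst b (W b)) b s • torusField (1, 0) b +
    mvfderiv torusModel (fun b => torusForm Prod.snd b (W b)) b s • torusField (0, 1) b) = _
  rw [map_add, map_smul, map_smul, torusForm_snd_torusField, torusForm_snd_torusField]
  simp

variable {J : E →L[ℝ] E} {g₀ g₁ g₂ : E → ℝ} {R : E →L[ℝ] E} {V₁ V₂ : E → E}

/-- Writing the first lift as R + V₁ splits off the flat connection, so V₁ and V₂ are the values of
the potential on ∂_θ₁ and ∂_θ₂. -/
theorem potential_spec (hJ : IsHermitianStructure J)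
    (h₀ : ContDiff ℝ ∞ g₀) (h₁ : ContDiff ℝ ∞ g₁) (h₂ : ContDiff ℝ ∞ g₂)
    (hR : IsHamiltonianLift J g₀ R) (hY₁ : IsHamiltonianLift J g₁ fun z => R z + V₁ z)
    (hY₂ : IsHamiltonianLift J g₂ V₂) (W : ∀ b : Torus, TangentSpace torusModel b)
    (p : SphereTorus E) :
    sphereDeriv d p (potential (sphereTorusModel d) torusModel Prod.snd
      (sphereTorusForm d J g₀ 0) (sphereTorusForm d J g₁ g₂) W p) =
        torusForm Prod.fst p.2 (W p.2) • V₁ p.1 + torusForm Prod.snd p.2 (W p.2) • V₂ p.1 ∧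
    torusDeriv d p (potential (sphereTorusModel d) torusModel Prod.snd
      (sphereTorusForm d J g₀ 0) (sphereTorusForm d J g₁ g₂) W p) = 0 := by
  obtain ⟨h1, h2⟩ := horizontalLift_spec (d := d) hJ h₁ h₂ hY₁ hY₂ W p
  obtain ⟨h3, h4⟩ := horizontalLift_spec (d := d) (g₂ := 0) hJ h₀ contDiff_const hR
    (isHamiltonianLift_zero J) W p
  unfold potential
  rw [map_sub, map_sub, h1, h2, h3, h4, sub_self]
  refine ⟨?_, rfl⟩
  simp only [Pi.zero_apply, smul_zero, add_zero, smul_add]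
  abel

/-- The hypotheses `hV₁`, `hV₂` say that R commutes with V₁ and V₂. Bracketing the flat lift of U
with w₁V₁ + w₂V₂ therefore differentiates only the coefficients, as the flat derivative on the torus
does. -/
theorem isStrongBourgeois_sphereTorusForm (hJ : IsHermitianStructure J)
    (h₀ : ContDiff ℝ ∞ g₀) (h₁ : ContDiff ℝ ∞ g₁) (h₂ : ContDiff ℝ ∞ g₂)
    (hR : IsHamiltonianLift J g₀ R) (hY₁ : IsHamiltonianLift J g₁ fun z => R z + V₁ z)
    (hY₂ : IsHamiltonianLift J g₂ V₂)
    (hκ : ∀ z, ‖z‖ = 1 → 2 * ⟪J (R z + V₁ z), V₂ z⟫ - fderiv ℝ g₁ z (V₂ z) +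
      fderiv ℝ g₂ z (R z + V₁ z) ≠ 0)
    (hd₁ : Differentiable ℝ V₁) (hd₂ : Differentiable ℝ V₂)
    (hV₁ : ∀ z, fderiv ℝ V₁ z (R z) = R (V₁ z)) (hV₂ : ∀ z, fderiv ℝ V₂ z (R z) = R (V₂ z)) :
    IsStrongBourgeois (sphereTorusModel d) torusModel torusFlat Prod.snd
      (sphereTorusForm (E := E) d J g₀ 0) (sphereTorusForm d J g₁ g₂) where
  contact := isContactForm_sphereTorusForm hJ h₁ h₂ hY₁ hY₂ hκ
  contactFibreBundle := isContactFibreBundle_sphereTorusForm hJ h₁ h₂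
  fibreField_eq p := by
    ext v
    rw [mem_fibreField_iff, mem_fibreField_iff]
  parallel W U hW hU p := by
    have hpot := potential_spec (d := d) hJ h₀ h₁ h₂ hR hY₁ hY₂
    have hlift := horizontalLift_spec (d := d) (g₂ := 0) hJ h₀ contDiff_const hR
      (isHamiltonianLift_zero J) U
    unfold covDerivPotential
    set X := horizontalLift (sphereTorusModel d) torusModel (Prod.snd : SphereTorus E → Torus)
      (contactConnection (sphereTorusModel d) torusModel Prod.snd (sphereTorusForm d J g₀ 0)) U
      with hX
    set Z := potential (sphereTorusModel d) torusModel (Prod.snd : SphereTorus E → Torus)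
      (sphereTorusForm d J g₀ 0) (sphereTorusForm d J g₁ g₂) W with hZ
    have hcoef : ∀ {f : Torus → Circle}, ContMDiff torusModel (𝓡 1) ∞ f →
        ∀ {W : ∀ b : Torus, TangentSpace torusModel b}, IsSmoothVectorField torusModel W →
        MDifferentiableAt torusModel 𝓘(ℝ, ℝ) (fun b => torusForm f b (W b)) p.2 := by
      intro f hf W hW
      have hW' : ContMDiff torusModel torusModel.tangent ∞
        (fun b => (⟨b, W b⟩ : TangentBundle torusModel Torus)) := hW
      exact mdifferentiableAt_torusForm hf ((hW' p.2).mdifferentiableAt (by simp))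
    have hsnd := (contMDiff_torusCoord (E := E) (d := d) p).mdifferentiableAt (by simp)
    have hcoef' : ∀ {f : Torus → Circle}, ContMDiff torusModel (𝓡 1) ∞ f →
        ∀ {W : ∀ b : Torus, TangentSpace torusModel b}, IsSmoothVectorField torusModel W →
        MDifferentiableAt (sphereTorusModel d) 𝓘(ℝ, ℝ)
          (fun q : SphereTorus E => torusForm f q.2 (W q.2)) p := fun hf _ hW =>
      (hcoef hf hW).comp p hsnd
    have haX : ∀ f : Torus → Circle, (fun q => angleForm d f q (X q)) =
        fun q : SphereTorus E => torusForm f q.2 (U q.2) := by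
      intro f
      funext q
      change torusForm f q.2 (torusDeriv d q (X q)) = _
      rw [(hlift q).2]
    have haZ : ∀ f : Torus → Circle, (fun q => angleForm d f q (Z q)) =
        fun q : SphereTorus E => (0 : ℝ) := by
      intro f
      funext q
      change torusForm f q.2 (torusDeriv d q (Z q)) = _
      rw [(hpot W q).2, map_zero]
    have hsX : (fun q => sphereDeriv d q (X q)) =
        fun q : SphereTorus E => torusForm Prod.fst q.2 (U q.2) • R q.1 := by
      funext q
      rw [(hlift q).1]
      simp
    have hsZ : (fun q => sphereDeriv d q (Z q)) =
        fun q : SphereTorus E => torusForm Prod.fst q.2 (W q.2) • V₁ q.1 +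
          torusForm Prod.snd q.2 (W q.2) • V₂ q.1 := funext fun q => (hpot W q).1
    have hcomp : ∀ {Y : E → E}, Differentiable ℝ Y → MDifferentiableAt (sphereTorusModel d)
        𝓘(ℝ, E) (fun q : SphereTorus E => Y q.1) p := fun hY =>
      (hY _).mdifferentiableAt.comp p
        ((contMDiff_sphereCoord (d := d) p).mdifferentiableAt (by simp))
    have hm₁ : MDifferentiableAt (sphereTorusModel d) 𝓘(ℝ, E)
        (fun q : SphereTorus E => torusForm Prod.fst q.2 (W q.2) • V₁ q.1) p :=
      (hcoef' contMDiff_fst hW).smul (hcomp hd₁)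
    have hm₂ : MDifferentiableAt (sphereTorusModel d) 𝓘(ℝ, E)
        (fun q : SphereTorus E => torusForm Prod.snd q.2 (W q.2) • V₂ q.1) p :=
      (hcoef' contMDiff_snd hW).smul (hcomp hd₂)
    -- The lifts are chosen point by point, so their regularity has to be recovered from their
    -- ambient coordinates.
    have hXd : DifferentiableAt ℝ (chartField X p) (extChartAt (sphereTorusModel d) p p) := by
      refine differentiableAt_chartField_of_coords ?_ ?_ ?_
      · rw [hsX]
        exact (hcoef' contMDiff_fst hU).smul (hcomp R.differentiable)
      · rw [haX]
        exact hcoef' contMDiff_fst hU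
      · rw [haX]
        exact hcoef' contMDiff_snd hU
    have hZd : DifferentiableAt ℝ (chartField Z p) (extChartAt (sphereTorusModel d) p p) := by
      refine differentiableAt_chartField_of_coords ?_ ?_ ?_
      · rw [hsZ]
        exact hm₁.add hm₂
      · rw [haZ]
        exact mdifferentiableAt_const
      · rw [haZ]
        exact mdifferentiableAt_const
    have hZ0 : ∀ {f : Torus → Circle}, ContMDiff torusModel (𝓡 1) ∞ f →
        -- The potential is vertical, so it annihilates functions pulled back from the torus.
        mvfderiv (sphereTorusModel d) (fun q : SphereTorus E => torusForm f q.2 (U q.2)) p (Z p) =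
          0 := by
      intro f hf
      rw [mvfderiv_comp_torusCoord (hcoef hf hU), (hpot W p).2, map_zero]
    have hXW : ∀ {f : Torus → Circle}, ContMDiff torusModel (𝓡 1) ∞ f →
        mvfderiv (sphereTorusModel d) (fun q : SphereTorus E => torusForm f q.2 (W q.2)) p (X p) =
          mvfderiv torusModel (fun b => torusForm f b (W b)) p.2 (U p.2) := by
      intro f hf
      rw [mvfderiv_comp_torusCoord (hcoef hf hW), (hlift p).2]
    have hangle : ∀ {f : Torus → Circle}, ContMDiff torusModel (𝓡 1) ∞ f →
        (∀ (p : SphereTorus E) (v : TangentSpace (sphereTorusModel d) p),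
          mvfderiv (sphereTorusModel d) (fun p : SphereTorus E => (f p.2 : ℂ)) p v =
            angleForm d f p v * Complex.I * f p.2) →
        angleForm d f p (VectorField.mlieBracket (sphereTorusModel d) X Z p) = 0 := by
      intro f hf hfd
      rw [angleForm_mlieBracket hf hfd hXd hZd, haZ, haX, hZ0 hf, mvfderiv_const]
      simp
    have hpa : ∀ f : Torus → Circle, angleForm d f p (potential (sphereTorusModel d) torusModel
        (Prod.snd : SphereTorus E → Torus) (sphereTorusForm d J g₀ 0) (sphereTorusForm d J g₁ g₂)
        (fun b => torusFlat W b (U b)) p) = 0 := by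
      intro f
      change torusForm f p.2 (torusDeriv d p _) = _
      rw [(hpot _ p).2, map_zero]
    have hsphere : sphereDeriv d p (VectorField.mlieBracket (sphereTorusModel d) X Z p) =
        mvfderiv torusModel (fun b => torusForm Prod.fst b (W b)) p.2 (U p.2) • V₁ p.1 +
        mvfderiv torusModel (fun b => torusForm Prod.snd b (W b)) p.2 (U p.2) • V₂ p.1 := by
      have hbr := mvfderiv_mlieBracket contMDiff_sphereCoord hXd hZd
      change sphereDeriv d p _ = mvfderiv _ (fun q => sphereDeriv d q (Z q)) _ _ -
        mvfderiv _ (fun q => sphereDeriv d q (X q)) _ _ at hbr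
      have hX1 : sphereDeriv d p (X p) = _ := congrFun hsX p
      have hZ1 : sphereDeriv d p (Z p) = _ := congrFun hsZ p
      rw [hbr, hsZ, hsX, mvfderiv_fun_add hm₁ hm₂, add_apply,
        mvfderiv_smul_comp_sphereCoord (hcoef' contMDiff_fst hW) (hd₁ _),
        mvfderiv_smul_comp_sphereCoord (hcoef' contMDiff_snd hW) (hd₂ _),
        mvfderiv_smul_comp_sphereCoord (hcoef' contMDiff_fst hU) R.differentiableAt,
        hXW contMDiff_fst, hXW contMDiff_snd, hZ0 contMDiff_fst, R.fderiv, hX1, hZ1]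
      -- Commutation turns DVᵢ(Rz) into R(Vᵢ), which cancels against the derivative of Rz along the
      -- potential.
      simp only [map_smul, map_add, hV₁, hV₂]
      module
    rw [sub_eq_zero]
    refine sphereTorus_ext ?_ ?_ ?_
    · rw [hsphere, (hpot _ p).1, torusForm_fst_torusFlat, torusForm_snd_torusFlat]
    · rw [hangle contMDiff_fst mvfderiv_circle_fst, hpa]
    · rw [hangle contMDiff_snd mvfderiv_circle_snd, hpa]

end Parallel

/-! ### Holonomy as the obstruction to triviality -/

section Holonomy

open Metric Module
open scoped RealInnerProductSpace

variable {E : Type*} [NormedAddCommGroup E] [InnerProductSpace ℝ E] {d : ℕ}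
  [Fact (finrank ℝ E = d + 1)] {J : E →L[ℝ] E} {g : E → ℝ} {R : E →L[ℝ] E}

/-- Parallel transport along a closed curve is trivial in a trivial flat contact fibre bundle. -/
theorem IsIsomorphicToTrivial.eq_of_horizontal_curve
    {E' : Type*} [NormedAddCommGroup E'] [NormedSpace ℝ E']
    {H : Type*} [TopologicalSpace H] {I : ModelWithCorners ℝ E' H}
    {V : Type*} [TopologicalSpace V] [ChartedSpace H V]
    {EM : Type*} [NormedAddCommGroup EM] [NormedSpace ℝ EM]
    {HM : Type*} [TopologicalSpace HM] {IM : ModelWithCorners ℝ EM HM}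
    {M : Type*} [TopologicalSpace M] [ChartedSpace HM M] [IsManifold IM ∞ M]
    {π : V → Torus} {α₀ : OneForm I V} {β : OneForm IM M}
    (h : IsIsomorphicToTrivial I IM π α₀ β) {c : ℝ → V} (hc : MDifferentiable 𝓘(ℝ, ℝ) I c)
    (hh : ∀ t, mfderiv 𝓘(ℝ, ℝ) I c t (1 : ℝ) ∈ contactConnection I torusModel π α₀ (c t))
    {s t : ℝ} (hst : π (c s) = π (c t)) : c s = c t := by
  obtain ⟨Ψ, hΨ, -, hconn⟩ := h
  have hΨd : MDifferentiable I (IM.prod torusModel) Ψ := Ψ.contMDiff.mdifferentiable (by simp)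
  have hγ : MDifferentiable 𝓘(ℝ, ℝ) IM (fun t => (Ψ (c t)).1) := fun t =>
    mdifferentiableAt_fst.comp t ((hΨd _).comp t (hc t))
  have h0 : ∀ t, mfderiv 𝓘(ℝ, ℝ) IM (fun t => (Ψ (c t)).1) t (1 : ℝ) = 0 := by
    intro t
    have h1 := mfderiv_comp t (g := (Prod.fst : M × Torus → M)) (f := Ψ ∘ c) (I := 𝓘(ℝ, ℝ))
      (I' := IM.prod torusModel) (I'' := IM) mdifferentiableAt_fst ((hΨd _).comp t (hc t))
    rw [mfderiv_fst, mfderiv_comp t (hΨd _) (hc t)] at h1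
    -- The velocity lands in 0 ⊕ TT², so its component along M vanishes.
    have h2 : mfderiv I (IM.prod torusModel) Ψ (c t) (mfderiv 𝓘(ℝ, ℝ) I c t (1 : ℝ)) ∈
        trivialConnection IM (Ψ (c t)) := by
      rw [← hconn]
      exact ⟨_, hh t, rfl⟩
    exact (DFunLike.congr_fun h1 (1 : ℝ)).trans h2.1
  refine Ψ.injective (Prod.ext (eq_of_mfderiv_curve_eq_zero hγ h0 s t) ?_)
  exact (hΨ _).trans (hst.trans (hΨ _).symm)

/-- A curve on the sphere that rotates with speed `1 / 2` in the plane spanned by `x` and `y`. -/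
def halfRotation (x y : E) (t : ℝ) : E := Real.cos (t / 2) • x + Real.sin (t / 2) • y

theorem norm_halfRotation {x y : E} (hx : ‖x‖ = 1) (hy : ‖y‖ = 1) (hxy : ⟪x, y⟫ = 0) (t : ℝ) :
    ‖halfRotation x y t‖ = 1 := by
  rw [← sq_eq_sq₀ (norm_nonneg _) zero_le_one, halfRotation, norm_add_sq_real, norm_smul, norm_smul,
    real_inner_smul_left, real_inner_smul_right, hxy, hx, hy, Real.norm_eq_abs, Real.norm_eq_abs,
    mul_one, mul_one, sq_abs, sq_abs]
  linarith [Real.sin_sq_add_cos_sq (t / 2)]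

theorem contDiff_halfRotation (x y : E) : ContDiff ℝ ∞ (halfRotation x y) := by
  unfold halfRotation
  fun_prop

theorem hasDerivAt_halfRotation (x y : E) (t : ℝ) :
    HasDerivAt (halfRotation x y)
      ((1 / 2 : ℝ) • (Real.cos (t / 2) • y - Real.sin (t / 2) • x)) t := by
  have h := (hasDerivAt_id t).div_const (2 : ℝ)
  have h1 := (h.cos.smul_const x).add (h.sin.smul_const y)
  refine h1.congr_deriv ?_
  simp only [id]
  module

/-- A connection over the torus that rotates some point of the sphere with speed `1 / 2` along the
first circle has nontrivial holonomy. -/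
theorem not_isIsomorphicToTrivial_sphereTorusForm
    {EM : Type*} [NormedAddCommGroup EM] [NormedSpace ℝ EM]
    {HM : Type*} [TopologicalSpace HM] {IM : ModelWithCorners ℝ EM HM}
    {M : Type*} [TopologicalSpace M] [ChartedSpace HM M] [IsManifold IM ∞ M] {β : OneForm IM M}
    (hJ : IsHermitianStructure J) (hg : ContDiff ℝ ∞ g) (hR : IsHamiltonianLift J g R)
    {x : E} (hx : ‖x‖ = 1) (hRx : R x = (1 / 2 : ℝ) • J x) (hRJx : R (J x) = -(1 / 2 : ℝ) • x) :
    ¬ IsIsomorphicToTrivial (sphereTorusModel d) IM Prod.snd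
      (sphereTorusForm d J g 0) β := by
  intro h
  have hJx : ‖J x‖ = 1 := by
    rw [← sq_eq_sq₀ (norm_nonneg _) zero_le_one, ← real_inner_self_eq_norm_sq, hJ.inner_map,
      real_inner_self_eq_norm_sq, hx]
  have hxJ : ⟪x, J x⟫ = 0 := by rw [real_inner_comm, hJ.inner_self]
  have hmem : ∀ t, halfRotation x (J x) t ∈ sphere (0 : E) 1 := fun t =>
    mem_sphere_zero_iff_norm.2 (norm_halfRotation hx hJx hxJ t)
  let σ : ℝ → sphere (0 : E) 1 := fun t => ⟨halfRotation x (J x) t, hmem t⟩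
  have hσ : ContMDiff 𝓘(ℝ, ℝ) (𝓡 d) ∞ σ :=
    (contDiff_halfRotation x (J x)).contMDiff.codRestrict_sphere hmem
  -- The horizontal lift through x of the first circle: its sphere component is exp(tR)x.
  let c : ℝ → SphereTorus E := fun t => (σ t, torusCurve (1, 0) 1 t)
  have hc : ContMDiff 𝓘(ℝ, ℝ) (sphereTorusModel d) ∞ c :=
    hσ.prodMk (contMDiff_torusCurve (1, 0) 1)
  have hcd : MDifferentiable 𝓘(ℝ, ℝ) (sphereTorusModel d) c := hc.mdifferentiable (by simp)
  have hsph : ∀ t, sphereDeriv d (c t) (mfderiv 𝓘(ℝ, ℝ) (sphereTorusModel d) c t (1 : ℝ)) =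
      R (c t).1 := by
    intro t
    have h1 := mfderiv_comp t ((contMDiff_sphereCoord (E := E) (d := d) (c t)).mdifferentiableAt
      (by simp)) (hcd t)
    rw [mfderiv_eq_fderiv] at h1
    refine (DFunLike.congr_fun h1 (1 : ℝ)).symm.trans ?_
    have h2 : fderiv ℝ (halfRotation x (J x)) t (1 : ℝ) = R (halfRotation x (J x) t) := by
      rw [fderiv_apply_one_eq_deriv, (hasDerivAt_halfRotation x (J x) t).deriv, halfRotation,
        map_add, map_smul, map_smul, hRx, hRJx]
      module
    exact h2
  have hang : ∀ t, angleForm d Prod.fst (c t)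
      (mfderiv 𝓘(ℝ, ℝ) (sphereTorusModel d) c t (1 : ℝ)) = 1 := by
    intro t
    have h1 := mfderiv_comp t ((contMDiff_circleCoord (E := E) (d := d) contMDiff_fst
      (c t)).mdifferentiableAt (by simp)) (hcd t)
    rw [mfderiv_eq_fderiv] at h1
    have h2 := (DFunLike.congr_fun h1 (1 : ℝ)).symm
    have h3 := (mvfderiv_circle_fst (c t)
      (mfderiv 𝓘(ℝ, ℝ) (sphereTorusModel d) c t (1 : ℝ))).symm.trans h2
    have h4 : HasDerivAt (fun t : ℝ => (((c t).2.1 : Circle) : ℂ))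
        (Complex.I * (c t).2.1) t := by
      have h5 : (fun t : ℝ => (((c t).2.1 : Circle) : ℂ)) =
          fun t : ℝ => Complex.exp ((t : ℂ) * Complex.I) := by
        funext t
        simp [c, torusCurve, Circle.coe_exp]
      have h6 := (((hasDerivAt_id t).ofReal_comp).mul_const Complex.I).cexp
      rw [congrFun h5 t, h5, mul_comm]
      simpa using h6
    have h7 : fderiv ℝ ((fun p : SphereTorus E => ((p.2.1 : Circle) : ℂ)) ∘ c) t (1 : ℝ) =
        Complex.I * (c t).2.1 := by
      rw [fderiv_apply_one_eq_deriv]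
      exact h4.deriv
    have h8 := h3.trans h7
    rw [mul_assoc] at h8
    have h9 := mul_right_cancel₀ (mul_ne_zero Complex.I_ne_zero (Circle.coe_ne_zero _))
      (h8.trans (one_mul _).symm)
    exact_mod_cast h9
  have hhor : ∀ t, mfderiv 𝓘(ℝ, ℝ) (sphereTorusModel d) c t (1 : ℝ) ∈
      contactConnection (sphereTorusModel d) torusModel Prod.snd
        (sphereTorusForm d J g 0) (c t) := by
    intro t
    rw [mem_contactConnection_iff hJ hg (g₂ := 0) contDiff_const hR (isHamiltonianLift_zero J),
      hsph, hang]
    simp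
  -- At time 2π the base curve has closed up, whereas the half-speed rotation has only reached -x;
  -- equality would force x = 0.
  have heq := h.eq_of_horizontal_curve hcd hhor (s := 0) (t := 2 * Real.pi)
    (by simp [c, torusCurve])
  have h1 : halfRotation x (J x) 0 = halfRotation x (J x) (2 * Real.pi) :=
    congrArg (fun p : SphereTorus E => (p.1 : E)) heq
  simp only [halfRotation, zero_div, Real.cos_zero, Real.sin_zero, zero_smul, one_smul, add_zero,
    mul_div_cancel_left₀ Real.pi (two_ne_zero), Real.cos_pi, Real.sin_pi, neg_smul] at h1
  rw [eq_neg_iff_add_eq_zero, ← two_smul ℝ, smul_eq_zero_iff_right two_ne_zero] at h1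
  rw [h1, norm_zero] at hx
  exact zero_ne_one hx

end Holonomy

/-! ### Contact vector fields with linear and quadratic Hamiltonians -/

section HamiltonianLifts

open scoped RealInnerProductSpace

variable {E : Type*} [NormedAddCommGroup E] [InnerProductSpace ℝ E] {J R : E →L[ℝ] E}

theorem IsHamiltonianLift.add {g₁ g₂ : E → ℝ} {Y₁ Y₂ : E → E} (h₁ : IsHamiltonianLift J g₁ Y₁)
    (h₂ : IsHamiltonianLift J g₂ Y₂) (hg₁ : Differentiable ℝ g₁) (hg₂ : Differentiable ℝ g₂) :
    IsHamiltonianLift J (fun z => g₁ z + g₂ z) (fun z => Y₁ z + Y₂ z) where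
  tangent z hz := by rw [inner_add_right, h₁.tangent z hz, h₂.tangent z hz, add_zero]
  hamiltonian z hz := by
    rw [inner_add_right, h₁.hamiltonian z hz, h₂.hamiltonian z hz]
    ring
  deriv z U hz hU hU' := by
    rw [fderiv_fun_add (hg₁ z) (hg₂ z), add_apply, ← h₁.deriv z U hz hU hU',
      ← h₂.deriv z U hz hU hU', map_add, inner_add_left, mul_add]

/-- The contact vector field on the unit sphere whose contact Hamiltonian is the linear function
`⟨a, z⟩`, for the contact form `⟨J z, dz⟩`. -/
def linearContactField (J : E →L[ℝ] E) (a z : E) : E :=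
  -- The first two terms are the tangential projection of Ja on the unit sphere; after halving they
  -- satisfy the derivative condition on ξ. The Reeb direction Jz is added to correct the value of λ
  -- to ⟨a, z⟩.
  (1 / 2 : ℝ) • (J a + ⟪J z, a⟫ • z + ⟪z, a⟫ • J z)

theorem hasFDerivAt_neg_inner (a z : E) :
    HasFDerivAt (fun z => -⟪a, z⟫) (-(innerSL ℝ a)) z :=
  (innerSL ℝ a).hasFDerivAt.neg

theorem isHamiltonianLift_linearContactField (hJ : IsHermitianStructure J) (a : E) :
    IsHamiltonianLift J (fun z => -⟪a, z⟫) (linearContactField J a) where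
  tangent z hz := by
    have h : ⟪z, z⟫ = 1 := by rw [real_inner_self_eq_norm_sq, hz, one_pow]
    simp only [linearContactField, inner_add_right, real_inner_smul_right, h,
      real_inner_comm (J z) z, hJ.inner_self, hJ.skew z a]
    ring
  hamiltonian z hz := by
    have h : ⟪z, z⟫ = 1 := by rw [real_inner_self_eq_norm_sq, hz, one_pow]
    simp only [linearContactField, inner_add_right, real_inner_smul_right, hJ.inner_map, h,
      hJ.inner_self, real_inner_comm z a]
    ring
  deriv z U hz hU hU' := by
    rw [(hasFDerivAt_neg_inner a z).fderiv]
    simp only [linearContactField, map_add, map_smul, inner_add_left, real_inner_smul_left, hJ.sq,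
      inner_neg_left, hU, hU', neg_apply, innerSL_apply_apply]
    ring

theorem hasFDerivAt_linearContactField (J : E →L[ℝ] E) (a z : E) :
    HasFDerivAt (linearContactField J a) ((1 / 2 : ℝ) •
      ((⟪J z, a⟫ • ContinuousLinearMap.id ℝ E +
        (((innerSL ℝ : E →L[ℝ] E →L[ℝ] ℝ).flip a).comp J).smulRight z) +
      (⟪z, a⟫ • J + ((innerSL ℝ : E →L[ℝ] E →L[ℝ] ℝ).flip a).smulRight (J z)))) z := by
  have h1 := (((innerSL ℝ : E →L[ℝ] E →L[ℝ] ℝ).flip a).comp J).hasFDerivAt (x := z)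
  have h2 := ((innerSL ℝ : E →L[ℝ] E →L[ℝ] ℝ).flip a).hasFDerivAt (x := z)
  have h := (((h1.smul (hasFDerivAt_id z)).const_add (J a)).add
    (h2.smul J.hasFDerivAt)).const_smul (1 / 2 : ℝ)
  exact h

/-- `R` is an infinitesimal unitary transformation. -/
structure IsSkewHermitian (J R : E →L[ℝ] E) : Prop where
  skew : ∀ x y, ⟪R x, y⟫ = -⟪x, R y⟫
  comm : ∀ x, R (J x) = J (R x)

/-- This is [R, V] = 0 for V the field of a. The unitary flow of R fixes a, hence preserves
everything V is built from. It holds on all of E, not only on the sphere. -/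
theorem fderiv_linearContactField_apply (hR : IsSkewHermitian J R) {a : E} (ha : R a = 0) (z : E) :
    fderiv ℝ (linearContactField J a) z (R z) = R (linearContactField J a z) := by
  have h1 : ⟪J (R z), a⟫ = 0 := by rw [← hR.comm, hR.skew, ha, inner_zero_right, neg_zero]
  have h2 : ⟪R z, a⟫ = 0 := by rw [hR.skew, ha, inner_zero_right, neg_zero]
  have h3 : fderiv ℝ (linearContactField J a) z (R z) = (1 / 2 : ℝ) •
      ((⟪J z, a⟫ • R z + ⟪J (R z), a⟫ • z) + (⟪z, a⟫ • J (R z) + ⟪R z, a⟫ • J z)) := by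
    rw [(hasFDerivAt_linearContactField J a z).fderiv]
    rfl
  rw [h3, h1, h2]
  simp only [linearContactField, map_smul, map_add, hR.comm, ha, map_zero]
  module

/-- The function `-⟨J z, R z⟩`, the negative of the contact Hamiltonian of `R`. -/
def quadraticHamiltonian (J R : E →L[ℝ] E) (z : E) : ℝ := -⟪J z, R z⟫

theorem contDiff_quadraticHamiltonian (J R : E →L[ℝ] E) :
    ContDiff ℝ ∞ (quadraticHamiltonian J R) :=
  (J.contDiff.inner ℝ R.contDiff).neg

/-- Since R is skew and commutes with J, the operator JR is symmetric and the function is its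
quadratic form ⟨JRz, z⟩. -/
theorem fderiv_quadraticHamiltonian_apply (hJ : IsHermitianStructure J) (hR : IsSkewHermitian J R)
    (z u : E) : fderiv ℝ (quadraticHamiltonian J R) z u = 2 * ⟪J (R z), u⟫ := by
  have h : fderiv ℝ (quadraticHamiltonian J R) z u = -(⟪J z, R u⟫ + ⟪J u, R z⟫) := by
    unfold quadraticHamiltonian
    rw [fderiv_fun_neg, neg_apply, fderiv_inner_apply ℝ J.differentiableAt R.differentiableAt,
      J.fderiv, R.fderiv]
  have h1 : ⟪J z, R u⟫ = -⟪J (R z), u⟫ := by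
    rw [← hR.comm, hR.skew, neg_neg]
  have h2 : ⟪J u, R z⟫ = -⟪J (R z), u⟫ := by
    rw [hJ.skew, real_inner_comm]
  rw [h, h1, h2]
  ring

theorem isHamiltonianLift_skewHermitian (hJ : IsHermitianStructure J) (hR : IsSkewHermitian J R) :
    IsHamiltonianLift J (quadraticHamiltonian J R) R where
  tangent z _ := by
    have := hR.skew z z
    rw [real_inner_comm] at this
    linarith
  hamiltonian z _ := (neg_neg _).symm
  deriv z U _ _ _ := (fderiv_quadraticHamiltonian_apply hJ hR z U).symm

/-- The curvature of the connection of a Bourgeois contact form does not vanish. -/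
theorem bourgeois_curvature_ne_zero (hJ : IsHermitianStructure J) (hR : IsSkewHermitian J R) {e : E}
    (he : ‖e‖ = 1) (hRe : R e = 0) {z : E} (hz : ‖z‖ = 1) :
    2 * ⟪J (R z + linearContactField J (-e) z), linearContactField J (J e) z⟫ -
      fderiv ℝ (fun z => quadraticHamiltonian J R z + -⟪-e, z⟫) z (linearContactField J (J e) z) +
      fderiv ℝ (fun z => -⟪J e, z⟫) z (R z + linearContactField J (-e) z) ≠ 0 := by
  have hd1 := (contDiff_quadraticHamiltonian J R).differentiable (by simp) z
  rw [fderiv_fun_add hd1 (hasFDerivAt_neg_inner (-e) z).differentiableAt,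
    (hasFDerivAt_neg_inner (-e) z).fderiv, (hasFDerivAt_neg_inner (J e) z).fderiv, add_apply,
    fderiv_quadraticHamiltonian_apply hJ hR]
  have hzz : ⟪z, z⟫ = 1 := by rw [real_inner_self_eq_norm_sq, hz, one_pow]
  have hee : ⟪e, e⟫ = 1 := by rw [real_inner_self_eq_norm_sq, he, one_pow]
  have h1 : ⟪J e, R z⟫ = 0 := by
    rw [real_inner_comm, hR.skew, hR.comm, hRe, map_zero, inner_zero_right, neg_zero]
  have h2 : ⟪J z, e⟫ = -⟪J e, z⟫ := by rw [hJ.skew, real_inner_comm]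
  have h3 : ⟪e, J z⟫ = -⟪J e, z⟫ := by rw [hJ.skew e z, neg_neg]
  have h4 : ⟪z, e⟫ = ⟪e, z⟫ := real_inner_comm _ _
  have h5 : ⟪z, J e⟫ = ⟪J e, z⟫ := real_inner_comm _ _
  have h6 : ⟪z, J z⟫ = 0 := by rw [real_inner_comm, hJ.inner_self]
  -- R drops out: 2⟨JRz, ·⟩ is exactly the differential of its Hamiltonian, and ⟨Je, Rz⟩ = 0 because
  -- R kills Je. What remains is the untwisted Bourgeois curvature (1 + |z₁|²)/2, positive even
  -- where z₁ = 0.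
  have key : 2 * ⟪J (R z + linearContactField J (-e) z), linearContactField J (J e) z⟫ -
      (2 * ⟪J (R z), linearContactField J (J e) z⟫ +
        (-(innerSL ℝ (-e))) (linearContactField J (J e) z)) +
      (-(innerSL ℝ (J e))) (R z + linearContactField J (-e) z) =
      (1 + ⟪e, z⟫ ^ 2 + ⟪J e, z⟫ ^ 2) / 2 := by
    rw [map_add J, inner_add_left]
    simp only [neg_apply, innerSL_apply_apply, inner_add_right, h1]
    simp only [linearContactField, map_add, map_smul, map_neg, hJ.sq, inner_add_left,
      inner_add_right, real_inner_smul_left, real_inner_smul_right, inner_neg_left,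
      inner_neg_right, neg_neg, hJ.inner_map, hJ.inner_self, hzz, hee, h2, h3, h4, h5, h6]
    ring
  rw [key]
  positivity

/-- The infinitesimal rotation with speed `1 / 2` in the complex line spanned by the unit vector
`x`. -/
def lineRotation (J : E →L[ℝ] E) (x : E) : E →L[ℝ] E :=
  (1 / 2 : ℝ) • ((innerSL ℝ x).smulRight (J x) - (innerSL ℝ (J x)).smulRight x)

theorem lineRotation_apply (J : E →L[ℝ] E) (x v : E) :
    lineRotation J x v = (1 / 2 : ℝ) • (⟪x, v⟫ • J x - ⟪J x, v⟫ • x) := rfl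

/-- For a unit vector x the operator is i/2 times the Hermitian projection onto the complex line of
x. -/
theorem isSkewHermitian_lineRotation (hJ : IsHermitianStructure J) (x : E) :
    IsSkewHermitian J (lineRotation J x) where
  skew u v := by
    simp only [lineRotation_apply, real_inner_smul_left, real_inner_smul_right, inner_sub_left,
      inner_sub_right, real_inner_comm x u, real_inner_comm (J x) u]
    ring
  comm v := by
    have h : ⟪x, J v⟫ = -⟪J x, v⟫ := by rw [hJ.skew, neg_neg]
    simp only [lineRotation_apply, map_smul, map_sub, hJ.sq, hJ.inner_map, h]
    module

end HamiltonianLifts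

/-! ### The model space ℂⁿ, with (a, b) standing for a + ib -/

section ComplexSpace

open scoped RealInnerProductSpace

/-- The real Euclidean space underlying `ℂⁿ`. -/
abbrev ComplexSpace (n : ℕ) : Type :=
  WithLp 2 (EuclideanSpace ℝ (Fin n) × EuclideanSpace ℝ (Fin n))

/-- Multiplication by `i` on `ℂⁿ`. -/
def complexMul (n : ℕ) : ComplexSpace n →L[ℝ] ComplexSpace n :=
  let A := EuclideanSpace ℝ (Fin n)
  (WithLp.prodContinuousLinearEquiv 2 ℝ A A).symm.toContinuousLinearMap.comp
    (((-ContinuousLinearMap.snd ℝ A A).prod (ContinuousLinearMap.fst ℝ A A)).comp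
      (WithLp.prodContinuousLinearEquiv 2 ℝ A A).toContinuousLinearMap)

theorem complexMul_apply (n : ℕ) (v : ComplexSpace n) :
    complexMul n v = WithLp.toLp 2 (-v.ofLp.2, v.ofLp.1) := rfl

theorem isHermitianStructure_complexMul (n : ℕ) : IsHermitianStructure (complexMul n) where
  skew v w := by
    simp only [complexMul_apply, WithLp.prod_inner_apply, inner_neg_left, inner_neg_right]
    ring
  sq v := by
    simp only [complexMul_apply]
    apply WithLp.ofLp_injective
    ext <;> simp

theorem finrank_complexSpace (n : ℕ) : Module.finrank ℝ (ComplexSpace n) = 2 * n := by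
  rw [(WithLp.linearEquiv 2 ℝ _).finrank_eq, Module.finrank_prod, finrank_euclideanSpace_fin]
  ring

/-- The vectors of the standard complex basis of `ℂⁿ`. -/
def complexBasis {n : ℕ} (i : Fin n) : ComplexSpace n :=
  WithLp.toLp 2 (EuclideanSpace.single i 1, 0)

theorem norm_complexBasis {n : ℕ} (i : Fin n) : ‖complexBasis i‖ = 1 := by
  rw [← sq_eq_sq₀ (norm_nonneg _) zero_le_one, ← real_inner_self_eq_norm_sq,
    WithLp.prod_inner_apply]
  simp [complexBasis]

theorem inner_complexBasis {n : ℕ} {i j : Fin n} (h : i ≠ j) :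
    ⟪complexBasis i, complexBasis j⟫ = 0 := by
  rw [WithLp.prod_inner_apply]
  simp [complexBasis, EuclideanSpace.inner_single_left, h]

theorem inner_complexMul_complexBasis {n : ℕ} (i j : Fin n) :
    ⟪complexMul n (complexBasis i), complexBasis j⟫ = 0 := by
  rw [WithLp.prod_inner_apply]
  simp [complexBasis, complexMul_apply]

end ComplexSpace

/-! ### Closed manifolds and the final choice of data -/

section Assembly

/-- The unit sphere of a Euclidean space of dimension `d + 1` as a closed manifold. -/
def sphereManifold (E : Type) [NormedAddCommGroup E] [InnerProductSpace ℝ E] (d : ℕ)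
    [Fact (Module.finrank ℝ E = d + 1)] : ClosedManifold d :=
  have : FiniteDimensional ℝ E := FiniteDimensional.of_fact_finrank_eq_succ d
  have : Nontrivial E := Module.nontrivial_of_finrank_pos (R := ℝ) (by
    rw [Fact.out (p := Module.finrank ℝ E = d + 1)]; omega)
  { carrier := Metric.sphere (0 : E) 1
    vec := EuclideanSpace ℝ (Fin d)
    space := EuclideanSpace ℝ (Fin d)
    model := 𝓡 d
    compact := isCompact_iff_compactSpace.1 (isCompact_sphere 0 1)
    nonempty := (NormedSpace.sphere_nonempty.2 zero_le_one).to_subtype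
    manifold := IsManifold.of_le (n := ω) le_top
    finrank_eq := by simp }

/-- The product of the unit sphere of a Euclidean space of dimension `d + 1` with the torus as a
closed manifold. -/
def sphereTorusManifold (E : Type) [NormedAddCommGroup E] [InnerProductSpace ℝ E] (d : ℕ)
    [Fact (Module.finrank ℝ E = d + 1)] : ClosedManifold (d + 2) :=
  have : FiniteDimensional ℝ E := FiniteDimensional.of_fact_finrank_eq_succ d
  have : Nontrivial E := Module.nontrivial_of_finrank_pos (R := ℝ) (by
    rw [Fact.out (p := Module.finrank ℝ E = d + 1)]; omega)
  have : CompactSpace (Metric.sphere (0 : E) 1) :=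
    isCompact_iff_compactSpace.1 (isCompact_sphere 0 1)
  have : Nonempty (Metric.sphere (0 : E) 1) :=
    (NormedSpace.sphere_nonempty.2 zero_le_one).to_subtype
  { carrier := SphereTorus E
    vec := EuclideanSpace ℝ (Fin d) × (EuclideanSpace ℝ (Fin 1) × EuclideanSpace ℝ (Fin 1))
    space := ModelProd (EuclideanSpace ℝ (Fin d))
      (ModelProd (EuclideanSpace ℝ (Fin 1)) (EuclideanSpace ℝ (Fin 1)))
    model := sphereTorusModel d
    finrank_eq := by simp }

theorem isSmoothFibreBundle_snd {E : Type*} [NormedAddCommGroup E] [NormedSpace ℝ E]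
    {H : Type*} [TopologicalSpace H] (I : ModelWithCorners ℝ E H)
    (F : Type*) [TopologicalSpace F] [ChartedSpace H F]
    {EB : Type*} [NormedAddCommGroup EB] [NormedSpace ℝ EB]
    {HB : Type*} [TopologicalSpace HB] (J : ModelWithCorners ℝ EB HB)
    (B : Type*) [TopologicalSpace B] [ChartedSpace HB B] :
    IsSmoothFibreBundle (I.prod J) J I F (Prod.snd : F × B → B) := fun b =>
  ⟨{ (Homeomorph.prodComm F B).toOpenPartialHomeomorph with
      baseSet := Set.univ
      open_baseSet := isOpen_univ
      source_eq := rfl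
      target_eq := Set.univ_prod_univ.symm
      proj_toFun := fun _ _ => rfl }, Set.mem_univ b,
    (contMDiff_snd.prodMk contMDiff_fst).contMDiffOn,
    (contMDiff_snd.prodMk contMDiff_fst).contMDiffOn⟩

end Assembly

theorem mainTheorem12 (n : ℕ) (hn : 2 ≤ n) :
    ∃ (F : ClosedManifold (2 * n - 1)) (V : ClosedManifold (2 * n + 1))
      (π : V.carrier → Torus) (α₀ α : OneForm V.model V.carrier),
      ConnectedSpace F.carrier ∧
      IsSmoothFibreBundle V.model torusModel F.model F.carrier π ∧
      IsFlatContactFibreBundle V.model torusModel π α₀ ∧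
      IsStrongBourgeois V.model torusModel torusFlat π α₀ α ∧
      ∀ (M : ClosedManifold (2 * n - 1)) (β : OneForm M.model M.carrier),
        IsContactForm M.model β → ¬ IsIsomorphicToTrivial V.model M.model π α₀ β := by
  have hfact : Fact (Module.finrank ℝ (ComplexSpace n) = (2 * n - 1) + 1) :=
    ⟨by rw [finrank_complexSpace]; omega⟩
  have hdim : 2 * n + 1 = (2 * n - 1) + 2 := by omega
  rw [hdim]
  -- Replaces the truncated difference by a variable d with dim ℂⁿ = d + 1, so that fibre and total
  -- space have dimensions d and d + 2 on the nose.
  generalize 2 * n - 1 = d at hfact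
  let J := complexMul n
  -- The line of e carries the potential and the line of x the holonomy; their orthogonality over ℂ
  -- gives R e = 0.
  let e : ComplexSpace n := complexBasis ⟨0, by omega⟩
  let x : ComplexSpace n := complexBasis ⟨1, by omega⟩
  let R := lineRotation J x
  have hJ : IsHermitianStructure J := isHermitianStructure_complexMul n
  have hR : IsSkewHermitian J R := isSkewHermitian_lineRotation hJ x
  have he : ‖e‖ = 1 := norm_complexBasis _
  have hx : ‖x‖ = 1 := norm_complexBasis _
  have hxe : inner ℝ x e = 0 := inner_complexBasis (by simp)
  have hJxe : inner ℝ (J x) e = 0 := inner_complexMul_complexBasis _ _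
  have hxx : inner ℝ x x = 1 := by rw [real_inner_self_eq_norm_sq, hx, one_pow]
  have hRe : R e = 0 := by
    rw [lineRotation_apply, hxe, hJxe]
    simp
  have hRx : R x = (1 / 2 : ℝ) • J x := by
    rw [lineRotation_apply, hxx, hJ.inner_self]
    simp
  have hRJx : R (J x) = -(1 / 2 : ℝ) • x := by
    rw [hR.comm, hRx, map_smul, hJ.sq]
    module
  have hH : IsHamiltonianLift J (quadraticHamiltonian J R) R := isHamiltonianLift_skewHermitian hJ hR
  have hg := contDiff_quadraticHamiltonian J R
  have hl : ∀ a : ComplexSpace n, ContDiff ℝ ∞ fun z => -inner ℝ a z := fun a =>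
    (innerSL ℝ a).contDiff.neg
  have hdV : ∀ a, Differentiable ℝ (linearContactField J a) := fun a z =>
    (hasFDerivAt_linearContactField J a z).differentiableAt
  refine ⟨sphereManifold (ComplexSpace n) d, sphereTorusManifold (ComplexSpace n) d, Prod.snd,
    sphereTorusForm d J (quadraticHamiltonian J R) 0,
    -- The pair -e, Je adds Re z₁ dθ₁ - Im z₁ dθ₂; with these signs the three terms of the curvature
    -- add up to a positive function.
    sphereTorusForm d J (fun z => quadraticHamiltonian J R z + -inner ℝ (-e) z)
      (fun z => -inner ℝ (J e) z), ?_, ?_, ?_, ?_, ?_⟩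
  · have hrank : 1 < Module.rank ℝ (ComplexSpace n) := by
      rw [← Module.finrank_eq_rank, finrank_complexSpace]
      exact_mod_cast (by omega : 1 < 2 * n)
    exact isConnected_iff_connectedSpace.1 (isConnected_sphere hrank 0 zero_le_one)
  · exact isSmoothFibreBundle_snd (𝓡 d) (Metric.sphere (0 : ComplexSpace n) 1) torusModel Torus
  · exact isFlatContactFibreBundle_sphereTorusForm hJ hg hH
  · exact isStrongBourgeois_sphereTorusForm hJ hg (hg.add (hl _)) (hl _) hH
      (hH.add (isHamiltonianLift_linearContactField hJ (-e)) (hg.differentiable (by simp))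
        ((hl _).differentiable (by simp)))
      (isHamiltonianLift_linearContactField hJ (J e))
      (fun z hz => bourgeois_curvature_ne_zero hJ hR he hRe hz) (hdV _) (hdV _)
      (fderiv_linearContactField_apply hR (by rw [map_neg, hRe, neg_zero]))
      (fderiv_linearContactField_apply hR (by rw [hR.comm, hRe, map_zero]))
  · intro M β _
    exact not_isIsomorphicToTrivial_sphereTorusForm hJ hg hH hx hRx hRJx
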